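/- For every integer $n \ge 0$ let $A_n$ be the number of perfect matchings (dimer coverings) of the $2n \times 2n$ square lattice graph, equivalently the number of ways to cover a $2n \times 2n$ chessboard with $2n^2$ dominoes, each covering two adjacent squares (so $A_0 = 1$). Then for every $n$ the positive real number $B_n$ defined by $A_n = 2^n B_n^2$, $B_n > 0$, is an integer, and $$B_{n+32} \equiv B_n + 32 \pmod{64} \qquad \text{for all } n \ge 0.$$ -/

import Mathlib

/-- The `2n × 2n` square lattice graph: vertices are the `4n²` squares of the `2n × 2n` board, and
two squares are adjacent when they are neighbours in the same row or in the same column. -/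
def squareLattice (n : ℕ) : SimpleGraph (Fin (2 * n) × Fin (2 * n)) :=
  SimpleGraph.boxProd (SimpleGraph.pathGraph (2 * n)) (SimpleGraph.pathGraph (2 * n))

/-- `A_n`: the number of dimer coverings (perfect matchings, i.e. domino tilings) of the
`2n × 2n` square lattice graph. -/
noncomputable def dimerCount (n : ℕ) : ℕ :=
  {M : (squareLattice n).Subgraph | M.IsPerfectMatching}.ncard

/-- The sign `1` or `-1` according to whether `x < y` or not. -/
def orderSign (x y : ℕ) : ℤ := if x < y then 1 else -1

/-- The sign of an ordered pair of arcs `{a, c}` and `{a', c'}`: it is `-1` when the two arcs cross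
and the first one starts first, and `1` otherwise. -/
def crossSign (a c a' c' : ℕ) : ℤ :=
  if min a c < min a' c' ∧ min a' c' < max a c ∧ max a c < max a' c' then -1 else 1

theorem orderSign_mul_self (x y : ℕ) : orderSign x y * orderSign x y = 1 := by
  unfold orderSign; split_ifs <;> rfl

theorem crossSign_self (a c : ℕ) : crossSign a c a c = 1 := by
  simp [crossSign]

theorem crossSign_mul_swap {a c a' c' : ℕ} (h : a < a') (hc : c ≠ c') (h1 : a ≠ c')
    (h2 : a' ≠ c) (h3 : a ≠ c) (h4 : a' ≠ c') :
    crossSign a c a' c' * crossSign a' c' a c =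
      -(orderSign c c') * (orderSign a c' * orderSign a' c) := by
  unfold crossSign orderSign
  rcases lt_or_gt_of_ne hc with hc | hc <;> rcases lt_or_gt_of_ne h1 with h1 | h1 <;>
  rcases lt_or_gt_of_ne h2 with h2 | h2 <;> rcases lt_or_gt_of_ne h3 with h3 | h3 <;>
  rcases lt_or_gt_of_ne h4 with h4 | h4 <;> first | omega | (
    simp only [min_def, max_def]
    split_ifs <;> first | rfl | omega)

/-- A product over all ordered pairs, split into the diagonal and the unordered pairs. -/
@[to_additive /-- A sum over all ordered pairs, split into the diagonal and the unordered pairs. -/]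
theorem prod_prod_eq_diag_mul_prod_Ioi {M : Type*} [CommMonoid M] {K : ℕ}
    (F : Fin K → Fin K → M) :
    ∏ i, ∏ j, F i j = (∏ i, F i i) * ∏ i, ∏ j ∈ Finset.Ioi i, F i j * F j i := by
  rw [Finset.prod_prod_Ioi_mul_eq_prod_prod_off_diag (fun j i => F i j), ← Finset.prod_mul_distrib]
  refine Finset.prod_congr rfl fun i _ => ?_
  rw [← Finset.mul_prod_erase _ _ (Finset.mem_univ i)]
  congr 2
  ext; simp

/-- The sign of a bijection between two interlaced sets of natural numbers, in terms of the
crossings of the arcs that join the points to their images. -/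
theorem sign_mul_prod_orderSign_mul_prod_crossSign {K : ℕ} {a c : Fin K → ℕ} (ha : StrictMono a)
    (hc : StrictMono c) (hac : ∀ i j, a i ≠ c j) (π : Equiv.Perm (Fin K)) :
    (Equiv.Perm.sign π : ℤ) * (∏ i, orderSign (a i) (c (π i))) *
      (∏ i, ∏ j, crossSign (a i) (c (π i)) (a j) (c (π j))) =
    (∏ i : Fin K, ∏ _j ∈ Finset.Ioi i, (-1 : ℤ)) * ∏ i, ∏ j, orderSign (a i) (c j) := by
  have hsign : (Equiv.Perm.sign π : ℤ) =
      ∏ i, ∏ j ∈ Finset.Ioi i, orderSign (c (π i)) (c (π j)) := by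
    rw [Equiv.Perm.sign_eq_prod_prod_Ioi]
    push_cast
    refine Finset.prod_congr rfl fun i _ => Finset.prod_congr rfl fun j _ => ?_
    simp only [orderSign, hc.lt_iff_lt]
    split_ifs <;> rfl
  have hcross : (∏ i, ∏ j, crossSign (a i) (c (π i)) (a j) (c (π j))) =
      (∏ i : Fin K, ∏ _j ∈ Finset.Ioi i, (-1 : ℤ)) *
      (∏ i, ∏ j ∈ Finset.Ioi i, orderSign (c (π i)) (c (π j))) *
      ∏ i, ∏ j ∈ Finset.Ioi i, (orderSign (a i) (c (π j)) * orderSign (a j) (c (π i))) := by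
    rw [prod_prod_eq_diag_mul_prod_Ioi]
    simp only [crossSign_self, Finset.prod_const_one, one_mul, ← Finset.prod_mul_distrib]
    refine Finset.prod_congr rfl fun i _ => Finset.prod_congr rfl fun j hj => ?_
    have hij : i < j := by simpa using hj
    rw [crossSign_mul_swap (ha hij) (hc.injective.ne (π.injective.ne hij.ne)) (hac _ _) (hac _ _)
      (hac _ _) (hac _ _), neg_one_mul]
  have hall : (∏ i, ∏ j, orderSign (a i) (c j)) = (∏ i, orderSign (a i) (c (π i))) *
      ∏ i, ∏ j ∈ Finset.Ioi i, (orderSign (a i) (c (π j)) * orderSign (a j) (c (π i))) := by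
    rw [← prod_prod_eq_diag_mul_prod_Ioi (fun i j => orderSign (a i) (c (π j)))]
    exact Finset.prod_congr rfl fun i _ => (Equiv.prod_comp π fun j => orderSign (a i) (c j)).symm
  have hsq : (∏ i, ∏ j ∈ Finset.Ioi i, orderSign (c (π i)) (c (π j))) *
      (∏ i, ∏ j ∈ Finset.Ioi i, orderSign (c (π i)) (c (π j))) = 1 := by
    simp only [← Finset.prod_mul_distrib, orderSign_mul_self, Finset.prod_const_one]
  rw [hsign, hcross, hall]
  linear_combination ((∏ i : Fin K, ∏ _j ∈ Finset.Ioi i, (-1 : ℤ)) *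
    (∏ i, orderSign (a i) (c (π i))) *
      ∏ i, ∏ j ∈ Finset.Ioi i, (orderSign (a i) (c (π j)) * orderSign (a j) (c (π i)))) * hsq

/-- The position of a square of the `N × N` board in row-major order. -/
def gridKey {N : ℕ} (v : Fin N × Fin N) : ℕ := N * v.1 + v.2

theorem gridKey_lt_iff {N : ℕ} (v w : Fin N × Fin N) :
    gridKey v < gridKey w ↔ (v.1 : ℕ) < w.1 ∨ (v.1 : ℕ) = w.1 ∧ (v.2 : ℕ) < w.2 := by
  obtain ⟨⟨a, ha⟩, ⟨b, hb⟩⟩ := v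
  obtain ⟨⟨c, hc⟩, ⟨d, hd⟩⟩ := w
  simp only [gridKey]
  rcases lt_trichotomy a c with h | h | h
  · have := Nat.mul_le_mul_left N (Nat.succ_le_of_lt h)
    rw [Nat.mul_succ] at this
    constructor <;> omega
  · subst h; omega
  · have := Nat.mul_le_mul_left N (Nat.succ_le_of_lt h)
    rw [Nat.mul_succ] at this
    constructor <;> omega

theorem gridKey_injective (N : ℕ) : Function.Injective (gridKey (N := N)) := by
  intro v w h
  have h1 := gridKey_lt_iff v w
  have h2 := gridKey_lt_iff w v
  ext <;> omega

/-- Two squares of the board are neighbours. -/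
def GridAdj {N : ℕ} (v w : Fin N × Fin N) : Prop :=
  ((w.1 : ℕ) = v.1 ∧ ((w.2 : ℕ) = v.2 + 1 ∨ (v.2 : ℕ) = w.2 + 1)) ∨
    ((w.2 : ℕ) = v.2 ∧ ((w.1 : ℕ) = v.1 + 1 ∨ (v.1 : ℕ) = w.1 + 1))

instance {N : ℕ} (v w : Fin N × Fin N) : Decidable (GridAdj v w) := by
  unfold GridAdj; infer_instance

theorem GridAdj.symm {N : ℕ} {v w : Fin N × Fin N} (h : GridAdj v w) : GridAdj w v := by
  unfold GridAdj at *; omega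

theorem crossSign_gridKey {N : ℕ} {v v' w w' : Fin N × Fin N}
    (hv : GridAdj v v') (hw : GridAdj w w') (hvw : v = w' ↔ w = v') :
    (if gridKey v < gridKey v' ∧ gridKey w < gridKey w' then
      crossSign (gridKey v) (gridKey v') (gridKey w) (gridKey w') else 1) =
    (if (v'.1 : ℕ) = v.1 + 1 ∧ (w'.1 : ℕ) = w.1 + 1 ∧ (v.1 : ℕ) = w.1 ∧ (v.2 : ℕ) < w.2
      then (-1 : ℤ) else 1) *
    (if (v'.1 : ℕ) = v.1 + 1 ∧ (w'.1 : ℕ) = w.1 + 1 ∧ (w.1 : ℕ) = v.1 + 1 ∧ (w.2 : ℕ) < v.2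
      then -1 else 1) := by
  have e : (if gridKey v < gridKey v' ∧ gridKey w < gridKey w' then
      crossSign (gridKey v) (gridKey v') (gridKey w) (gridKey w') else 1) =
      if (gridKey v < gridKey v' ∧ gridKey w < gridKey w') ∧ gridKey v < gridKey w ∧
        gridKey w < gridKey v' ∧ gridKey v' < gridKey w' then (-1 : ℤ) else 1 := by
    by_cases h : gridKey v < gridKey v' ∧ gridKey w < gridKey w'
    · simp only [h, crossSign, min_eq_left h.1.le, min_eq_left h.2.le, max_eq_right h.1.le,
        max_eq_right h.2.le, if_true, true_and, and_self]
    · simp only [h, false_and, if_false]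
  rw [e]
  simp only [gridKey_lt_iff]
  simp only [Prod.ext_iff, Fin.ext_iff] at hvw
  unfold GridAdj at hv hw
  obtain ⟨⟨a, ha⟩, ⟨b, hb⟩⟩ := v
  obtain ⟨⟨c, hc⟩, ⟨d, hd⟩⟩ := w
  obtain ⟨⟨a', ha'⟩, ⟨b', hb'⟩⟩ := v'
  obtain ⟨⟨c', hc'⟩, ⟨d', hd'⟩⟩ := w'
  simp only at hv hw hvw ⊢
  clear e
  split_ifs <;> first | rfl | (exfalso; omega)

section Involution

variable {N : ℕ} {f : Fin N × Fin N → Fin N × Fin N}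

/-- If `v` is matched to the square below it, then the number of squares `(v.1 + 1, j)` with
`j < v.2` that are matched vertically has the parity of `v.2`. -/
theorem prod_vertical_left (hf : Function.Involutive f) (hadj : ∀ v, GridAdj v (f v))
    (v : Fin N × Fin N) (hv : ((f v).1 : ℕ) = v.1 + 1) :
    ∏ x : Fin N × Fin N, (if ((x.1 : ℕ) = v.1 + 1 ∧ (x.2 : ℕ) < v.2) ∧ (f x).2 = x.2
      then (-1 : ℤ) else 1) = (-1) ^ (v.2 : ℕ) := by
  set X : Finset (Fin N × Fin N) := Finset.univ.filter
    fun x => (x.1 : ℕ) = v.1 + 1 ∧ (x.2 : ℕ) < v.2 with hX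
  have hcard : ∏ x ∈ X, (-1 : ℤ) = (-1) ^ (v.2 : ℕ) := by
    rw [Finset.prod_const]
    congr 1
    have : X = {(f v).1} ×ˢ Finset.Iio v.2 := by
      ext x
      simp only [hX, Finset.mem_filter, Finset.mem_univ, true_and, Finset.mem_product,
        Finset.mem_singleton, Finset.mem_Iio, Fin.ext_iff, hv, Fin.lt_def]
    rw [this]; simp
  have hhor : ∏ x ∈ X with (f x).2 ≠ x.2, (-1 : ℤ) = 1 := by
    refine Finset.prod_involution (fun x _ => f x) (by simp) ?_ ?_ ?_
    · intro x _ _ h2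
      have := hadj x
      rw [h2] at this
      unfold GridAdj at this
      omega
    · intro x hx
      simp only [hX, Finset.mem_filter, Finset.mem_univ, true_and, ne_eq, Fin.ext_iff, hf x]
        at hx ⊢
      have h1 := hadj x
      have h2 := hadj v
      have h3 : f x = f v → x = v := fun h => hf.injective h
      simp only [Prod.ext_iff, Fin.ext_iff] at h3
      unfold GridAdj at h1 h2
      omega
    · exact fun x _ => hf x
  rw [← hcard, ← Finset.prod_filter_mul_prod_filter_not X (fun x => (f x).2 = x.2), hhor, mul_one,
    ← Finset.prod_filter, hX, Finset.filter_filter]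

/-- The crossings of a perfect matching of the grid. -/
theorem prod_crossSign_gridKey (hf : Function.Involutive f) (hadj : ∀ v, GridAdj v (f v)) :
    ∏ v, ∏ w, (if gridKey v < gridKey (f v) ∧ gridKey w < gridKey (f w) then
      crossSign (gridKey v) (gridKey (f v)) (gridKey w) (gridKey (f w)) else 1) =
    ∏ v, if ((f v).1 : ℕ) = v.1 + 1 then (-1 : ℤ) ^ (v.2 : ℕ) else 1 := by
  have hvw : ∀ v w, v = f w ↔ w = f v := fun v w =>
    ⟨fun h => by rw [h, hf], fun h => by rw [h, hf]⟩
  simp only [crossSign_gridKey (hadj _) (hadj _) (hvw _ _), Finset.prod_mul_distrib]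
  rw [Finset.prod_comm, ← Finset.prod_mul_distrib]
  refine Finset.prod_congr rfl fun v _ => ?_
  rw [← Equiv.prod_comp hf.toPerm, ← Finset.prod_mul_distrib]
  split_ifs with hv
  · rw [← prod_vertical_left hf hadj v hv]
    refine Finset.prod_congr rfl fun x _ => ?_
    have h1 := hadj x
    simp only [Function.Involutive.coe_toPerm, hf x, hv, Fin.ext_iff, true_and]
    unfold GridAdj at h1
    split_ifs <;> first | rfl | (exfalso; omega)
  · simp [hv]

end Involution

/-- The finite set `s` of squares, enumerated in row-major order. -/
theorem exists_strictMono_enum {N K : ℕ} (s : Finset (Fin N × Fin N)) (hs : s.card = K) :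
    ∃ u : Fin K → Fin N × Fin N, StrictMono (fun i => gridKey (u i)) ∧ ∀ v, v ∈ s ↔ ∃ i, u i = v := by
  set T : Finset ℕ := s.map ⟨gridKey, gridKey_injective N⟩ with hT
  have hTc : T.card = K := by rw [hT, Finset.card_map, hs]
  have hmem : ∀ i, ∃ v ∈ s, gridKey v = T.orderEmbOfFin hTc i := fun i => by
    have := T.orderEmbOfFin_mem hTc i
    obtain ⟨v, hv, h⟩ := Finset.mem_map.1 this
    exact ⟨v, hv, h⟩
  choose u hu hk using hmem
  refine ⟨u, fun i j hij => ?_, fun v => ⟨fun hv => ?_, ?_⟩⟩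
  · simpa only [hk] using (T.orderEmbOfFin hTc).strictMono hij
  · have : gridKey v ∈ Set.range (T.orderEmbOfFin hTc) := by
      rw [Finset.range_orderEmbOfFin]
      simp only [hT, Finset.coe_map, Function.Embedding.coeFn_mk]
      exact ⟨v, hv, rfl⟩
    obtain ⟨i, hi⟩ := this
    exact ⟨i, gridKey_injective N (by rw [hk, hi])⟩
  · rintro ⟨i, rfl⟩
    exact hu i

/-- The black and the white squares of an even board, both enumerated in row-major order. -/
theorem exists_bipartite_enum (n : ℕ) : ∃ (K : ℕ) (e : Fin K ⊕ Fin K ≃ Fin (2 * n) × Fin (2 * n)),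
    StrictMono (fun i => gridKey (e (.inl i))) ∧ StrictMono (fun i => gridKey (e (.inr i))) ∧
    (∀ i, ((e (.inl i)).1 + (e (.inl i)).2 : ℕ) % 2 = 0) ∧
    (∀ i, ((e (.inr i)).1 + (e (.inr i)).2 : ℕ) % 2 = 1) := by
  set s : Finset (Fin (2 * n) × Fin (2 * n)) :=
    Finset.univ.filter fun v => ((v.1 + v.2 : ℕ) % 2 = 0) with hs
  set t : Finset (Fin (2 * n) × Fin (2 * n)) :=
    Finset.univ.filter fun v => ((v.1 + v.2 : ℕ) % 2 = 1) with ht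
  have hst : t.card = s.card := by
    refine Finset.card_nbij' (fun v => (v.1, v.2.rev)) (fun v => (v.1, v.2.rev)) ?_ ?_ ?_ ?_
    · intro v hv
      simp only [ht, hs, Finset.coe_filter, Finset.mem_univ, true_and, Set.mem_ofPred_eq,
        Fin.val_rev] at hv ⊢
      omega
    · intro v hv
      simp only [ht, hs, Finset.coe_filter, Finset.mem_univ, true_and, Set.mem_ofPred_eq,
        Fin.val_rev] at hv ⊢
      omega
    · intro v _; simp
    · intro v _; simp
  obtain ⟨u, hu, hus⟩ := exists_strictMono_enum s rfl
  obtain ⟨w, hw, hwt⟩ := exists_strictMono_enum t hst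
  have hu0 : ∀ i, ((u i).1 + (u i).2 : ℕ) % 2 = 0 := fun i => by
    simpa [hs] using (hus (u i)).2 ⟨i, rfl⟩
  have hw1 : ∀ i, ((w i).1 + (w i).2 : ℕ) % 2 = 1 := fun i => by
    simpa [ht] using (hwt (w i)).2 ⟨i, rfl⟩
  have hbij : Function.Bijective (Sum.elim u w) := by
    constructor
    · refine Function.Injective.sumElim (fun i j h => hu.injective (congrArg gridKey h))
        (fun i j h => hw.injective (congrArg gridKey h)) fun i j h => ?_
      have h1 := hu0 i
      rw [h, hw1 j] at h1
      exact one_ne_zero h1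
    · intro v
      rcases Nat.mod_two_eq_zero_or_one (v.1 + v.2 : ℕ) with h | h
      · obtain ⟨i, hi⟩ := (hus v).1 (by simpa [hs] using h)
        exact ⟨.inl i, hi⟩
      · obtain ⟨i, hi⟩ := (hwt v).1 (by simpa [ht] using h)
        exact ⟨.inr i, hi⟩
  exact ⟨s.card, Equiv.ofBijective _ hbij, hu, hw, hu0, hw1⟩

theorem squareLattice_adj {n : ℕ} {v w : Fin (2 * n) × Fin (2 * n)} :
    (squareLattice n).Adj v w ↔ GridAdj v w := by
  simp only [squareLattice, SimpleGraph.boxProd_adj, SimpleGraph.pathGraph_adj, Fin.ext_iff,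
    GridAdj]
  omega

section Matching

variable {V : Type*} {K : ℕ} (e : Fin K ⊕ Fin K ≃ V)

/-- The involution of a bipartite vertex set that matches the `i`-th black vertex with the
`π i`-th white vertex. -/
def matchInvolution (π : Equiv.Perm (Fin K)) (v : V) : V :=
  e (Sum.elim (fun i => .inr (π i)) (fun j => .inl (π.symm j)) (e.symm v))

@[simp] theorem matchInvolution_inl (π : Equiv.Perm (Fin K)) (i : Fin K) :
    matchInvolution e π (e (.inl i)) = e (.inr (π i)) := by simp [matchInvolution]

@[simp] theorem matchInvolution_inr (π : Equiv.Perm (Fin K)) (i : Fin K) :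
    matchInvolution e π (e (.inr i)) = e (.inl (π.symm i)) := by simp [matchInvolution]

theorem matchInvolution_involutive (π : Equiv.Perm (Fin K)) :
    Function.Involutive (matchInvolution e π) := by
  intro v
  obtain ⟨x | x, rfl⟩ := e.surjective v <;> simp

variable {e} in
theorem adj_matchInvolution {G : SimpleGraph V} {π : Equiv.Perm (Fin K)}
    (h : ∀ i, G.Adj (e (.inl i)) (e (.inr (π i)))) (v : V) : G.Adj v (matchInvolution e π v) := by
  obtain ⟨x | x, rfl⟩ := e.surjective v
  · simpa using h x
  · simpa using (h (π.symm x)).symm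

/-- The perfect matchings of a bipartite graph are the bijections between the colour classes
along edges. -/
theorem ncard_isPerfectMatching (G : SimpleGraph V)
    (h1 : ∀ i j, ¬G.Adj (e (.inl i)) (e (.inl j))) :
    {M : G.Subgraph | M.IsPerfectMatching}.ncard =
      {π : Equiv.Perm (Fin K) | ∀ i, G.Adj (e (.inl i)) (e (.inr (π i)))}.ncard := by
  symm
  refine Set.ncard_congr (fun π hπ =>
    { verts := Set.univ
      Adj := fun v w => w = matchInvolution e π v
      adj_sub := ?_
      edge_vert := fun _ => Set.mem_univ _
      symm := ?_ }) ?_ ?_ ?_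
  · rintro v w rfl
    exact adj_matchInvolution hπ v
  · refine ⟨?_⟩
    rintro v w rfl
    exact (matchInvolution_involutive e π v).symm
  · intro π hπ
    rw [Set.mem_ofPred_eq, SimpleGraph.Subgraph.isPerfectMatching_iff]
    exact fun v => ⟨_, rfl, fun _ h => h⟩
  · intro π π' _ _ h
    ext1 i
    have h2 := congrFun (congrFun (congrArg SimpleGraph.Subgraph.Adj h) (e (.inl i)))
      (e (.inr (π i)))
    simpa using h2
  · intro M hM
    rw [Set.mem_ofPred_eq, SimpleGraph.Subgraph.isPerfectMatching_iff] at hM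
    choose f hf hfu using hM
    have hinv : Function.Involutive f := fun v => (hfu (f v) v (hf v).symm).symm
    have hwhite : ∀ i, ∃ j, e (.inr j) = f (e (.inl i)) := fun i => by
      obtain ⟨x | x, hx⟩ := e.surjective (f (e (.inl i)))
      · exact absurd (M.adj_sub (hf (e (.inl i)))) (hx ▸ h1 i x)
      · exact ⟨x, hx⟩
    choose p hp using hwhite
    have hpinj : Function.Injective p := fun i j hij => by
      have := hinv.injective ((hp i).symm.trans ((congrArg (fun x => e (.inr x)) hij).trans (hp j)))
      simpa using this
    set π : Equiv.Perm (Fin K) := Equiv.ofBijective p (Finite.injective_iff_bijective.1 hpinj)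
    have hπ : ∀ i, e (.inr (π i)) = f (e (.inl i)) := hp
    have hfπ : ∀ v, f v = matchInvolution e π v := fun v => by
      obtain ⟨x | x, rfl⟩ := e.surjective v
      · rw [matchInvolution_inl, hπ]
      · rw [matchInvolution_inr, ← hinv.injective.eq_iff, hinv, ← hπ, Equiv.apply_symm_apply]
    refine ⟨π, fun i => by rw [hπ]; exact M.adj_sub (hf _), ?_⟩
    refine SimpleGraph.Subgraph.ext ?_ ?_
    · exact (Set.eq_univ_of_forall fun v => M.edge_vert (hf v)).symm
    · ext v w
      change w = matchInvolution e π v ↔ M.Adj v w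
      rw [← hfπ]
      exact ⟨fun h => h ▸ hf v, fun h => hfu v w h⟩

end Matching

open scoped Kronecker

/-- The antisymmetric adjacency matrix of the path, oriented from left to right. -/
def pathMatrix (N : ℕ) : Matrix (Fin N) (Fin N) ℤ :=
  Matrix.of fun i j => if (j : ℕ) = i + 1 then 1 else if (i : ℕ) = j + 1 then -1 else 0

/-- The diagonal matrix of alternating signs. -/
def alternatingMatrix (N : ℕ) : Matrix (Fin N) (Fin N) ℤ :=
  Matrix.diagonal fun j => (-1) ^ (j : ℕ)

/-- The Kasteleyn matrix of the `N × N` board. -/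
def kasteleynMatrix (N : ℕ) : Matrix (Fin N × Fin N) (Fin N × Fin N) ℤ :=
  1 ⊗ₖ pathMatrix N + pathMatrix N ⊗ₖ alternatingMatrix N

theorem pathMatrix_transpose (N : ℕ) : (pathMatrix N).transpose = -pathMatrix N := by
  ext i j
  simp only [pathMatrix, Matrix.transpose_apply, Matrix.of_apply, Matrix.neg_apply]
  split_ifs <;> first | rfl | omega

theorem alternatingMatrix_sq (N : ℕ) : alternatingMatrix N * alternatingMatrix N = 1 := by
  rw [alternatingMatrix, Matrix.diagonal_mul_diagonal, ← Matrix.diagonal_one]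
  congr 1
  ext j
  rw [← mul_pow]; simp

theorem pathMatrix_mul_alternatingMatrix (N : ℕ) :
    pathMatrix N * alternatingMatrix N = -(alternatingMatrix N * pathMatrix N) := by
  ext i j
  rw [alternatingMatrix, Matrix.mul_diagonal, Matrix.neg_apply, Matrix.diagonal_mul]
  simp only [pathMatrix, Matrix.of_apply]
  split_ifs with h h
  · rw [h]; ring
  · rw [h]; ring
  · ring

theorem kasteleynMatrix_transpose (N : ℕ) :
    (kasteleynMatrix N).transpose = -kasteleynMatrix N := by
  rw [kasteleynMatrix, Matrix.transpose_add, ← Matrix.kroneckerMap_transpose,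
    ← Matrix.kroneckerMap_transpose, pathMatrix_transpose, alternatingMatrix,
    Matrix.diagonal_transpose, Matrix.transpose_one]
  ext ⟨a, b⟩ ⟨c, d⟩
  simp only [Matrix.add_apply, Matrix.kroneckerMap_apply, Matrix.neg_apply]
  ring

theorem kasteleynMatrix_mul_transpose (N : ℕ) :
    kasteleynMatrix N * (kasteleynMatrix N).transpose =
      1 ⊗ₖ (pathMatrix N * (pathMatrix N).transpose) +
        (pathMatrix N * (pathMatrix N).transpose) ⊗ₖ 1 := by
  have h : pathMatrix N ⊗ₖ (pathMatrix N * alternatingMatrix N) +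
      pathMatrix N ⊗ₖ (alternatingMatrix N * pathMatrix N) = 0 := by
    rw [← Matrix.kronecker_add, pathMatrix_mul_alternatingMatrix, neg_add_cancel,
      Matrix.kronecker_zero]
  have h2 : kasteleynMatrix N * kasteleynMatrix N =
      1 ⊗ₖ (pathMatrix N * pathMatrix N) + (pathMatrix N * pathMatrix N) ⊗ₖ 1 := by
    rw [kasteleynMatrix, Matrix.add_mul, Matrix.mul_add, Matrix.mul_add, ← Matrix.mul_kronecker_mul,
      ← Matrix.mul_kronecker_mul, ← Matrix.mul_kronecker_mul, ← Matrix.mul_kronecker_mul,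
      alternatingMatrix_sq, Matrix.one_mul, Matrix.one_mul, Matrix.mul_one,
      add_assoc, ← add_assoc (pathMatrix N ⊗ₖ _), h, zero_add]
  rw [kasteleynMatrix_transpose, pathMatrix_transpose, Matrix.mul_neg, h2]
  ext ⟨a, b⟩ ⟨c, d⟩
  simp only [Matrix.add_apply, Matrix.kroneckerMap_apply, Matrix.neg_apply, Matrix.mul_neg]
  ring

theorem kasteleynMatrix_apply {N : ℕ} (v w : Fin N × Fin N) :
    kasteleynMatrix N v w = if GridAdj v w then orderSign (gridKey v) (gridKey w) *
      (if v.2 = w.2 then (-1) ^ (v.2 : ℕ) else 1) else 0 := by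
  simp only [kasteleynMatrix, Matrix.add_apply, Matrix.kroneckerMap_apply, Matrix.one_apply,
    pathMatrix, alternatingMatrix, Matrix.of_apply, Matrix.diagonal_apply, orderSign,
    gridKey_lt_iff, GridAdj, Fin.ext_iff]
  split_ifs <;> omega

section Sum

variable {V : Type*} [Fintype V] {K : ℕ} (e : Fin K ⊕ Fin K ≃ V) (key : V → ℕ)

theorem prod_inl_eq_prod_ite {M : Type*} [CommMonoid M] (hkey : Function.Injective key)
    (π : Equiv.Perm (Fin K)) (g : V → M) (hg : ∀ v, g (matchInvolution e π v) = g v) :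
    ∏ i, g (e (.inl i)) = ∏ v, if key v < key (matchInvolution e π v) then g v else 1 := by
  rw [← Equiv.prod_comp e, Fintype.prod_sum_type, ← Equiv.prod_comp π (fun i => ite (key (e (.inr i)) < _) _ _),
    ← Finset.prod_mul_distrib]
  refine Finset.prod_congr rfl fun i _ => ?_
  have h1 : key (e (.inl i)) ≠ key (e (.inr (π i))) := fun h => by
    simpa using e.injective (hkey h)
  have h2 := hg (e (.inl i))
  simp only [matchInvolution_inl, matchInvolution_inr, Equiv.symm_apply_apply] at h2 ⊢
  rw [h2]
  rcases lt_or_gt_of_ne h1 with h | h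
  · simp [h, h.not_gt]
  · simp [h, h.not_gt]

end Sum

/-- Kasteleyn's theorem for the even square board: up to a sign that does not depend on it, every
perfect matching contributes `1` to the determinant. -/
theorem sign_mul_prod_kasteleynMatrix {N K : ℕ} (e : Fin K ⊕ Fin K ≃ Fin N × Fin N)
    (hu : StrictMono (fun i => gridKey (e (.inl i))))
    (hw : StrictMono (fun i => gridKey (e (.inr i)))) (π : Equiv.Perm (Fin K))
    (hπ : ∀ i, GridAdj (e (.inl i)) (e (.inr (π i)))) :
    (Equiv.Perm.sign π : ℤ) * ∏ i, kasteleynMatrix N (e (.inl i)) (e (.inr (π i))) =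
    (∏ i : Fin K, ∏ _j ∈ Finset.Ioi i, (-1 : ℤ)) *
      ∏ i, ∏ j, orderSign (gridKey (e (.inl i))) (gridKey (e (.inr j))) := by
  set f := matchInvolution e π with hf
  have hinv : Function.Involutive f := matchInvolution_involutive e π
  have hfi : ∀ i, e (.inr (π i)) = f (e (.inl i)) := fun i => by simp [hf]
  have hadj : ∀ v, GridAdj v (f v) := fun v => by
    obtain ⟨x | x, rfl⟩ := e.surjective v
    · rw [← hfi]; exact hπ x
    · have := (hπ (π.symm x)).symm
      simpa [hf] using this
  have key := gridKey_injective N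
  have hne : ∀ i j, gridKey (e (.inl i)) ≠ gridKey (e (.inr j)) := fun i j h => by
    simpa using e.injective (key h)
  rw [← sign_mul_prod_orderSign_mul_prod_crossSign hu hw hne π, mul_assoc]
  congr 1
  simp only [kasteleynMatrix_apply, hπ, if_true, Finset.prod_mul_distrib]
  congr 1
  have hswap : ∀ a c a' c', crossSign c a a' c' = crossSign a c a' c' := fun a c a' c' => by
    simp only [crossSign, min_comm c, max_comm c]
  have hswap' : ∀ a c a' c', crossSign a c c' a' = crossSign a c a' c' := fun a c a' c' => by
    simp only [crossSign, min_comm c', max_comm c']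
  have hcross : ∏ i, ∏ j, crossSign (gridKey (e (.inl i))) (gridKey (e (.inr (π i))))
      (gridKey (e (.inl j))) (gridKey (e (.inr (π j)))) =
      ∏ v, ∏ w, (if gridKey v < gridKey (f v) ∧ gridKey w < gridKey (f w) then
        crossSign (gridKey v) (gridKey (f v)) (gridKey w) (gridKey (f w)) else 1) := by
    simp only [hfi]
    rw [prod_inl_eq_prod_ite e gridKey key π (fun v => ∏ j, crossSign (gridKey v) (gridKey (f v))
      (gridKey (e (.inl j))) (gridKey (f (e (.inl j))))) fun v => by simp only [← hf, hinv v, hswap]]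
    refine Finset.prod_congr rfl fun v _ => ?_
    rw [prod_inl_eq_prod_ite e gridKey key π (fun w => crossSign (gridKey v) (gridKey (f v))
      (gridKey w) (gridKey (f w))) fun w => by simp only [← hf, hinv w, hswap']]
    split_ifs with h
    · rw [← hf] at h
      refine Finset.prod_congr rfl fun w _ => ?_
      simp only [h, true_and, ← hf]
    · simp only [← hf] at h
      simp [h]
  rw [hcross, prod_crossSign_gridKey hinv hadj]
  simp only [hfi]
  rw [prod_inl_eq_prod_ite e gridKey key π
    (fun v => if v.2 = (f v).2 then (-1 : ℤ) ^ (v.2 : ℕ) else 1) fun v => ?_]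
  · refine Finset.prod_congr rfl fun v _ => ?_
    have := hadj v
    simp only [← hf, gridKey_lt_iff]
    simp only [GridAdj] at this
    simp only [Fin.ext_iff]
    split_ifs <;> first | rfl | (exfalso; omega)
  · simp only [← hf, hinv v]
    by_cases h : v.2 = (f v).2
    · simp [h]
    · simp [h, Ne.symm h]

theorem abs_orderSign (x y : ℕ) : |orderSign x y| = 1 := by
  unfold orderSign; split_ifs <;> rfl

/-- The fourth power of the number of domino tilings is a determinant. -/
theorem dimerCount_pow_four (n : ℕ) :
    (dimerCount n : ℤ) ^ 4 = (1 ⊗ₖ (pathMatrix (2 * n) * (pathMatrix (2 * n)).transpose) +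
        (pathMatrix (2 * n) * (pathMatrix (2 * n)).transpose) ⊗ₖ 1).det := by
  obtain ⟨K, e, hu, hw, hb, hwh⟩ := exists_bipartite_enum n
  set A : Matrix (Fin K) (Fin K) ℤ :=
    Matrix.of fun j i => kasteleynMatrix (2 * n) (e (.inl i)) (e (.inr j)) with hA
  have hbb : ∀ i j, ¬GridAdj (e (.inl i)) (e (.inl j)) := fun i j h => by
    have := hb i; have := hb j; unfold GridAdj at h; omega
  have hww : ∀ i j, ¬GridAdj (e (.inr i)) (e (.inr j)) := fun i j h => by
    have := hwh i; have := hwh j; unfold GridAdj at h; omega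
  set C : ℤ := (∏ i : Fin K, ∏ _j ∈ Finset.Ioi i, (-1 : ℤ)) *
      ∏ i, ∏ j, orderSign (gridKey (e (.inl i))) (gridKey (e (.inr j))) with hC
  have hC1 : |C| = 1 := by
    simp [hC, abs_mul, Finset.abs_prod, abs_orderSign]
  have hdet : A.det = C * dimerCount n := by
    classical
    rw [dimerCount, ncard_isPerfectMatching e (squareLattice n)
      (fun i j => by rw [squareLattice_adj]; exact hbb i j), Matrix.det_apply]
    simp only [squareLattice_adj]
    have hset : {π : Equiv.Perm (Fin K) | ∀ i, GridAdj (e (.inl i)) (e (.inr (π i)))} =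
        ((Finset.univ.filter fun π : Equiv.Perm (Fin K) =>
          ∀ i, GridAdj (e (.inl i)) (e (.inr (π i)))) : Set (Equiv.Perm (Fin K))) := by
      ext π; simp
    rw [hset, Set.ncard_coe_finset, Finset.card_filter, Nat.cast_sum, Finset.mul_sum]
    refine Finset.sum_congr rfl fun π _ => ?_
    rw [Units.smul_def, smul_eq_mul]
    split_ifs with h
    · rw [Nat.cast_one, mul_one, hC, ← sign_mul_prod_kasteleynMatrix e hu hw π h]
      rfl
    · push Not at h
      obtain ⟨i, hi⟩ := h
      rw [Finset.prod_eq_zero (Finset.mem_univ i) (by simp [hA, kasteleynMatrix_apply, hi])]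
      simp
  have hblock : (kasteleynMatrix (2 * n)).submatrix e e =
      Matrix.fromBlocks 0 A.transpose (-A) 0 := by
    ext (i | i) (j | j)
    · simp [kasteleynMatrix_apply, hbb]
    · rfl
    · have := congrFun (congrFun (kasteleynMatrix_transpose (2 * n)) (e (.inl j))) (e (.inr i))
      simpa [hA] using this
    · simp [kasteleynMatrix_apply, hww]
  have hpow : (kasteleynMatrix (2 * n) * (kasteleynMatrix (2 * n)).transpose).det = A.det ^ 4 := by
    rw [← Matrix.det_submatrix_equiv_self e, ← Matrix.submatrix_mul_equiv _ _ e e e,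
      ← Matrix.transpose_submatrix, hblock, Matrix.fromBlocks_transpose,
      Matrix.fromBlocks_multiply]
    simp
    ring
  rw [← kasteleynMatrix_mul_transpose, hpow, hdet, mul_pow, ← Even.pow_abs (by decide) C, hC1,
    one_pow, one_mul]

theorem pathMatrix_mulVec {N : ℕ} {h : ℕ → ℂ} (h0 : h 0 = 0) (hN : h (N + 1) = 0) (j : Fin N) :
    ((pathMatrix N).map (Int.cast : ℤ → ℂ)).mulVec (fun l => h (l + 1)) j = h (j + 2) - h j := by
  have hterm : ∀ l : Fin N, ((pathMatrix N).map (Int.cast : ℤ → ℂ)) j l * h (l + 1) =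
      (fun m : ℕ => (if m = (j : ℕ) + 1 then h (m + 1) else 0) -
        (if m + 1 = (j : ℕ) then h (m + 1) else 0)) l := fun l => by
    simp only [pathMatrix, Matrix.map_apply, Matrix.of_apply]
    split_ifs <;> first | omega | simp
  rw [Matrix.mulVec, dotProduct, Finset.sum_congr rfl fun l _ => hterm l,
    Fin.sum_univ_eq_sum_range (fun m : ℕ => (if m = (j : ℕ) + 1 then h (m + 1) else 0) -
        (if m + 1 = (j : ℕ) then h (m + 1) else 0)), Finset.sum_sub_distrib]
  congr 1
  · rw [Finset.sum_ite_eq']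
    split_ifs with hj
    · rfl
    · have : (j : ℕ) + 2 = N + 1 := by
        have := j.2; simp at hj; omega
      rw [this, hN]
  · rcases hj : (j : ℕ) with _ | m
    · simp [h0]
    · simp only [Nat.add_right_cancel_iff]
      rw [Finset.sum_ite_eq', if_pos]
      have := j.2; simp; omega

/-- The entries of the eigenvectors of `pathMatrix`. -/
noncomputable def pathEigen (θ : ℝ) (m : ℕ) : ℂ := Complex.I ^ m * (Real.sin (m * θ) : ℝ)

theorem pathEigen_sub (θ : ℝ) (j : ℕ) : pathEigen θ (j + 2) - pathEigen θ j =
    (2 * Complex.I * (Real.cos θ : ℝ)) * pathEigen θ (j + 1) := by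
  have h : Real.sin ((j + 2 : ℕ) * θ) + Real.sin (j * θ) =
      2 * Real.cos θ * Real.sin ((j + 1 : ℕ) * θ) := by
    have h1 : ((j + 2 : ℕ) : ℝ) * θ = (j + 1 : ℕ) * θ + θ := by push_cast; ring
    have h2 : (j : ℝ) * θ = (j + 1 : ℕ) * θ - θ := by push_cast; ring
    rw [h1, h2, Real.sin_add, Real.sin_sub]; ring
  have h' := congrArg (fun x : ℝ => (x : ℂ)) h
  simp only [Complex.ofReal_add, Complex.ofReal_mul, Complex.ofReal_ofNat] at h'
  unfold pathEigen
  rw [pow_add, pow_succ Complex.I j, Complex.I_sq]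
  linear_combination (-Complex.I ^ j) * h' - (2 * (Real.cos θ : ℂ) * Complex.I ^ j *
    (Real.sin ((j + 1 : ℕ) * θ) : ℝ)) * Complex.I_sq

/-- The matrix of eigenvectors of `pathMatrix N`. -/
noncomputable def pathEigenMatrix (N : ℕ) : Matrix (Fin N) (Fin N) ℂ :=
  Matrix.of fun j k => pathEigen (Real.pi * (k + 1) / (N + 1)) (j + 1)

theorem pathMatrix_mulVec_pathEigenMatrix (N : ℕ) (k : Fin N) :
    ((pathMatrix N).map (Int.cast : ℤ → ℂ)).mulVec ((pathEigenMatrix N).col k) =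
      (2 * Complex.I * (Real.cos (Real.pi * (k + 1) / (N + 1)) : ℝ)) • (pathEigenMatrix N).col k := by
  ext j
  have := pathMatrix_mulVec (N := N) (h := pathEigen (Real.pi * (k + 1) / (N + 1)))
    (by simp [pathEigen]) (by
      have : ((N + 1 : ℕ) : ℝ) * (Real.pi * (k + 1) / (N + 1)) = (k + 1 : ℕ) * Real.pi := by
        push_cast; field_simp
      rw [pathEigen, this, Real.sin_nat_mul_pi]; simp) j
  rw [pathEigen_sub] at this
  exact this

theorem isUnit_pathEigenMatrix (N : ℕ) : IsUnit (pathEigenMatrix N) := by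
  rw [← Matrix.linearIndependent_cols_iff_isUnit]
  have hmem : ∀ k : Fin N, Real.pi * (k + 1) / (N + 1) ∈ Set.Ioo 0 Real.pi := fun k => by
    have hk : ((k : ℕ) : ℝ) + 1 < N + 1 := by exact_mod_cast Nat.succ_lt_succ k.2
    constructor
    · have := Real.pi_pos; positivity
    · rw [div_lt_iff₀ (by positivity)]
      exact mul_lt_mul_of_pos_left hk Real.pi_pos
  refine Module.End.eigenvectors_linearIndependent'
    (Matrix.toLin' ((pathMatrix N).map (Int.cast : ℤ → ℂ)))
    (fun k : Fin N => 2 * Complex.I * (Real.cos (Real.pi * (k + 1) / (N + 1)) : ℝ)) ?_ _ fun k => ?_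
  · intro k l hkl
    have h2 : (2 * Complex.I : ℂ) ≠ 0 := by simp
    have h3 := Complex.ofReal_injective (mul_left_cancel₀ h2 hkl)
    have h4 := Real.injOn_cos (Set.Ioo_subset_Icc_self (hmem k)) (Set.Ioo_subset_Icc_self (hmem l)) h3
    have hN : (N : ℝ) + 1 ≠ 0 := by positivity
    field_simp at h4
    ext
    have h5 : ((k : ℕ) : ℝ) = (l : ℕ) := by linarith
    exact_mod_cast h5
  · rw [Module.End.hasEigenvector_iff, Module.End.mem_eigenspace_iff, Matrix.toLin'_apply]
    refine ⟨pathMatrix_mulVec_pathEigenMatrix N k, fun h => ?_⟩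
    have h0 := congrFun h ⟨0, k.pos⟩
    have hs := Real.sin_pos_of_mem_Ioo (hmem k)
    simp only [Matrix.col, pathEigenMatrix, Matrix.transpose_apply, Matrix.of_apply, pathEigen,
      Pi.zero_apply] at h0
    norm_num at h0
    exact hs.ne' (by exact_mod_cast h0)

theorem pathMatrix_mul_pathEigenMatrix (N : ℕ) :
    (pathMatrix N * (pathMatrix N).transpose).map (Int.cast : ℤ → ℂ) * pathEigenMatrix N =
      pathEigenMatrix N * Matrix.diagonal fun k : Fin N =>
        ((4 * Real.cos (Real.pi * (k + 1) / (N + 1)) ^ 2 : ℝ) : ℂ) := by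
  set J := (pathMatrix N).map (Int.cast : ℤ → ℂ) with hJ
  set D := Matrix.diagonal fun k : Fin N =>
    2 * Complex.I * (Real.cos (Real.pi * (k + 1) / (N + 1)) : ℝ) with hD
  have h1 : J * pathEigenMatrix N = pathEigenMatrix N * D := by
    ext j k
    have := congrFun (pathMatrix_mulVec_pathEigenMatrix N k) j
    rw [hD, Matrix.mul_diagonal, mul_comm]
    exact this
  have h2 : (pathMatrix N * (pathMatrix N).transpose).map (Int.cast : ℤ → ℂ) = -(J * J) := by
    rw [pathMatrix_transpose, Matrix.mul_neg, hJ]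
    ext i j
    simp [Matrix.mul_apply]
  rw [h2, Matrix.neg_mul, Matrix.mul_assoc, h1, ← Matrix.mul_assoc, h1, Matrix.mul_assoc,
    ← Matrix.mul_neg, hD, Matrix.diagonal_mul_diagonal, Matrix.diagonal_neg]
  congr 2
  ext k
  simp only [Complex.ofReal_mul, Complex.ofReal_pow, Complex.ofReal_ofNat]
  linear_combination (-4 * (Real.cos (Real.pi * (k + 1) / (N + 1)) : ℂ) ^ 2) * Complex.I_sq

theorem det_kronecker_one_add_one_kronecker {ι F : Type*} [Fintype ι] [DecidableEq ι] [Field F]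
    {C U : Matrix ι ι F} {μ : ι → F} (hU : IsUnit U) (h : C * U = U * Matrix.diagonal μ) :
    (1 ⊗ₖ C + C ⊗ₖ 1).det = ∏ k, ∏ l, (μ k + μ l) := by
  have hd : (U ⊗ₖ U).det ≠ 0 := by
    rw [Matrix.det_kronecker]
    have := (Matrix.isUnit_iff_isUnit_det _).1 hU
    exact mul_ne_zero (pow_ne_zero _ this.ne_zero) (pow_ne_zero _ this.ne_zero)
  have h2 : (1 ⊗ₖ C + C ⊗ₖ 1) * (U ⊗ₖ U) =
      (U ⊗ₖ U) * Matrix.diagonal fun p : ι × ι => μ p.1 + μ p.2 := by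
    have h3 : (Matrix.diagonal fun p : ι × ι => μ p.1 + μ p.2) =
        1 ⊗ₖ Matrix.diagonal μ + Matrix.diagonal μ ⊗ₖ 1 := by
      rw [← Matrix.diagonal_one, Matrix.diagonal_kronecker_diagonal,
        Matrix.diagonal_kronecker_diagonal, Matrix.diagonal_add]
      congr 1; ext p; ring
    rw [h3, Matrix.add_mul, Matrix.mul_add, ← Matrix.mul_kronecker_mul, ← Matrix.mul_kronecker_mul,
      ← Matrix.mul_kronecker_mul, ← Matrix.mul_kronecker_mul, h, Matrix.one_mul, Matrix.mul_one]
  have h4 := congrArg Matrix.det h2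
  rw [Matrix.det_mul, Matrix.det_mul, mul_comm] at h4
  rw [mul_left_cancel₀ hd h4, Matrix.det_diagonal, Fintype.prod_prod_type]

@[to_additive sum_range_two_mul_of_symm]
theorem prod_range_two_mul_of_symm {M : Type*} [CommMonoid M] (n : ℕ) (g : ℕ → M)
    (hg : ∀ k < n, g (n + k) = g (n - 1 - k)) :
    ∏ k ∈ Finset.range (2 * n), g k = (∏ k ∈ Finset.range n, g k) ^ 2 := by
  rw [two_mul, Finset.prod_range_add, pow_two]
  congr 1
  refine Finset.prod_nbij' (fun k => n - 1 - k) (fun k => n - 1 - k) ?_ ?_ ?_ ?_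
    fun k hk => hg k (Finset.mem_range.1 hk)
  all_goals
    intro k hk
    simp only [Finset.mem_range] at hk ⊢
    omega

/-- The eigenvalues `4 cos² (π (k + 1) / (2 n + 1))`. -/
noncomputable def gridEigen (n k : ℕ) : ℝ := 4 * Real.cos (Real.pi * (k + 1) / (2 * n + 1)) ^ 2

theorem gridEigen_symm {n k : ℕ} (hk : k < n) : gridEigen n (n + k) = gridEigen n (n - 1 - k) := by
  have h : Real.pi * ((n + k : ℕ) + 1) / (2 * n + 1) =
      Real.pi - Real.pi * ((n - 1 - k : ℕ) + 1) / (2 * n + 1) := by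
    have : ((n - 1 - k : ℕ) : ℝ) = n - 1 - k := by
      rw [Nat.sub_sub, Nat.cast_sub (by omega)]; push_cast; ring
    rw [this]; field_simp; push_cast; ring
  rw [gridEigen, gridEigen, h, Real.cos_pi_sub, neg_sq]

theorem gridEigen_pos {n k : ℕ} (hk : k < n) : 0 < gridEigen n k := by
  have hn : (k : ℝ) + 1 ≤ n := by exact_mod_cast hk
  have : 0 < Real.cos (Real.pi * (k + 1) / (2 * n + 1)) := by
    apply Real.cos_pos_of_mem_Ioo
    have := Real.pi_pos
    constructor
    · have : 0 < Real.pi * (k + 1) / (2 * n + 1) := by positivity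
      linarith
    · rw [div_lt_iff₀ (by positivity)]; nlinarith
  unfold gridEigen; positivity

/-- The Kasteleyn–Temperley–Fisher product formula. -/
theorem dimerCount_eq_prod (n : ℕ) : (dimerCount n : ℝ) =
    ∏ k ∈ Finset.range n, ∏ l ∈ Finset.range n, (gridEigen n k + gridEigen n l) := by
  have h := congrArg (Int.cast : ℤ → ℂ) (dimerCount_pow_four n)
  have hmap : ((1 ⊗ₖ (pathMatrix (2 * n) * (pathMatrix (2 * n)).transpose) +
      (pathMatrix (2 * n) * (pathMatrix (2 * n)).transpose) ⊗ₖ 1).map (Int.cast : ℤ → ℂ)) =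
      1 ⊗ₖ (pathMatrix (2 * n) * (pathMatrix (2 * n)).transpose).map (Int.cast : ℤ → ℂ) +
      (pathMatrix (2 * n) * (pathMatrix (2 * n)).transpose).map (Int.cast : ℤ → ℂ) ⊗ₖ 1 := by
    ext ⟨a, b⟩ ⟨c, d⟩
    simp [Matrix.one_apply]
  rw [Int.cast_det, hmap, det_kronecker_one_add_one_kronecker (isUnit_pathEigenMatrix _)
    (pathMatrix_mul_pathEigenMatrix _)] at h
  have hR : (dimerCount n : ℝ) ^ 4 = ∏ k : Fin (2 * n), ∏ l : Fin (2 * n),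
      (gridEigen n k + gridEigen n l) := by
    apply Complex.ofReal_injective
    push_cast [gridEigen] at h ⊢
    exact h
  have hfin : (∏ k : Fin (2 * n), ∏ l : Fin (2 * n), (gridEigen n k + gridEigen n l)) =
      (∏ k ∈ Finset.range n, ∏ l ∈ Finset.range n, (gridEigen n k + gridEigen n l)) ^ 4 := by
    have hrow : ∀ k, ∏ l : Fin (2 * n), (gridEigen n k + gridEigen n l) =
        (∏ l ∈ Finset.range n, (gridEigen n k + gridEigen n l)) ^ 2 := fun k => by
      rw [Fin.prod_univ_eq_prod_range (fun l => (gridEigen n k + gridEigen n l)),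
        prod_range_two_mul_of_symm _ _ fun k hk => by simp only [gridEigen_symm hk]]
    rw [Fin.prod_univ_eq_prod_range (fun k => ∏ l : Fin (2 * n), (gridEigen n k + gridEigen n l)),
      prod_range_two_mul_of_symm _ _ fun k hk => by simp only [gridEigen_symm hk]]
    simp only [hrow, Finset.prod_pow, ← pow_mul]
  rw [hfin] at hR
  refine (pow_left_inj₀ (by positivity) (Finset.prod_nonneg fun k hk => Finset.prod_nonneg
    fun l hl => ?_) (by norm_num)).1 hR
  exact (add_pos (gridEigen_pos (Finset.mem_range.1 hk)) (gridEigen_pos (Finset.mem_range.1 hl))).le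

/-- The value `2 cos (2 π a / (2 n + 1))` as the sum of an additive character and its inverse. -/
noncomputable def twoCos (n : ℕ) (a : ZMod (2 * n + 1)) : ℂ :=
  ZMod.stdAddChar a + ZMod.stdAddChar (-a)

section TwoCos

variable {n : ℕ}

theorem twoCos_zero : twoCos n 0 = 2 := by
  simp [twoCos]; norm_num

theorem twoCos_neg (a : ZMod (2 * n + 1)) : twoCos n (-a) = twoCos n a := by
  rw [twoCos, twoCos, neg_neg, add_comm]

theorem twoCos_mul (a b : ZMod (2 * n + 1)) :
    twoCos n a * twoCos n b = twoCos n (a + b) + twoCos n (a - b) := by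
  simp only [twoCos, sub_eq_add_neg, neg_add, neg_neg, AddChar.map_add_eq_mul]
  ring

theorem twoCos_two_mul (a : ZMod (2 * n + 1)) : twoCos n (2 * a) + 2 = twoCos n a ^ 2 := by
  rw [sq, twoCos_mul, sub_self, twoCos_zero, two_mul]

theorem two_mul_add_one_eq_zero : (2 * n + 1 : ZMod (2 * n + 1)) = 0 := by
  exact_mod_cast ZMod.natCast_self (2 * n + 1)

theorem isUnit_two : IsUnit (2 : ZMod (2 * n + 1)) :=
  IsUnit.of_mul_eq_one (-(n : ZMod (2 * n + 1)))
    (by linear_combination -two_mul_add_one_eq_zero (n := n))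

theorem two_mul_natCast_ne_zero {r : ℕ} (h0 : 0 < r) (hr : r ≤ 2 * n) :
    (2 * r : ZMod (2 * n + 1)) ≠ 0 := fun h => by
  rw [isUnit_two.mul_right_eq_zero, ZMod.natCast_eq_zero_iff] at h
  exact absurd (Nat.le_of_dvd h0 h) (by omega)

theorem sum_twoCos (c : ZMod (2 * n + 1)) :
    ∑ u, twoCos n (c * u) = if c = 0 then (2 * (2 * n + 1) : ℂ) else 0 := by
  have h := AddChar.sum_mulShift c (ZMod.isPrimitive_stdAddChar (2 * n + 1))
  have h' := AddChar.sum_mulShift (-c) (ZMod.isPrimitive_stdAddChar (2 * n + 1))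
  simp only [twoCos, Finset.sum_add_distrib, mul_comm c, ← mul_neg, h, h', neg_eq_zero, ZMod.card]
  split_ifs <;> push_cast <;> ring

theorem twoCos_mul_sum (u : ZMod (2 * n + 1)) (m : ℕ) :
    twoCos n u * (1 + ∑ r ∈ Finset.range m, (-1) ^ (r + 1) * twoCos n (2 * (r + 1 : ℕ) * u)) =
      (-1) ^ m * twoCos n ((2 * m + 1) * u) := by
  induction m with
  | zero => simp
  | succ m ih =>
    have h := twoCos_mul (n := n) (2 * (m + 1 : ℕ) * u) u
    have h1 : 2 * (m + 1 : ℕ) * u + u = (2 * (m + 1 : ℕ) + 1) * u := by ring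
    have h2 : 2 * (m + 1 : ℕ) * u - u = (2 * m + 1) * u := by push_cast; ring
    rw [h1, h2] at h
    rw [Finset.sum_range_succ, ← add_assoc, mul_add, ih]
    linear_combination (-1) ^ (m + 1) * h

theorem twoCos_inv (u : ZMod (2 * n + 1)) :
    (twoCos n u)⁻¹ = (-1) ^ n / 2 *
      (1 + ∑ r ∈ Finset.range n, (-1) ^ (r + 1) * twoCos n (2 * (r + 1 : ℕ) * u)) := by
  have h := twoCos_mul_sum u n
  rw [two_mul_add_one_eq_zero, zero_mul, twoCos_zero] at h
  refine inv_eq_of_mul_eq_one_right ?_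
  have h1 : ((-1 : ℂ) ^ n) * (-1) ^ n = 1 := by rw [← mul_pow]; simp
  linear_combination ((-1) ^ n / 2) * h + h1

theorem twoCos_ne_zero (u : ZMod (2 * n + 1)) : twoCos n u ≠ 0 := fun h0 => by
  have h := twoCos_mul_sum u n
  rw [two_mul_add_one_eq_zero, zero_mul, twoCos_zero, h0, zero_mul] at h
  simp at h

theorem twoCos_sq_mul_sum (c : ℂ) (u : ZMod (2 * n + 1)) (m : ℕ) :
    twoCos n u ^ 2 * (c + ∑ r ∈ Finset.range m,
      (-1) ^ (r + 1) * (c - 2 * (r + 1 : ℕ)) * twoCos n (2 * (r + 1 : ℕ) * u)) =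
      4 + (-1) ^ m * ((c - 2 * m - 2) * twoCos n (2 * m * u) +
        (c - 2 * m) * twoCos n (2 * (m + 1 : ℕ) * u)) := by
  induction m with
  | zero =>
    rw [← twoCos_two_mul]
    simp [twoCos_zero]; ring
  | succ m ih =>
    have h := twoCos_mul (n := n) (2 * (m + 1 : ℕ) * u) (2 * u)
    have h1 : 2 * (m + 1 : ℕ) * u + 2 * u = 2 * (m + 1 + 1 : ℕ) * u := by push_cast; ring
    have h2 : 2 * (m + 1 : ℕ) * u - 2 * u = 2 * m * u := by push_cast; ring
    rw [h1, h2] at h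
    rw [Finset.sum_range_succ, ← add_assoc, mul_add, ih, ← twoCos_two_mul]
    push_cast at h ⊢
    linear_combination (-1) ^ (m + 1) * (c - 2 * (m + 1)) * h

theorem twoCos_sq_inv (u : ZMod (2 * n + 1)) :
    (twoCos n u ^ 2)⁻¹ = 1 / 4 * ((2 * n + 1) + ∑ r ∈ Finset.range n, (-1) ^ (r + 1) *
      ((2 * n + 1) - 2 * (r + 1 : ℕ)) * twoCos n (2 * (r + 1 : ℕ) * u)) := by
  have h := twoCos_sq_mul_sum (2 * n + 1) u n
  have h1 : 2 * (n + 1 : ℕ) * u = -(2 * n * u) := by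
    push_cast; linear_combination 2 * u * two_mul_add_one_eq_zero (n := n)
  rw [h1, twoCos_neg] at h
  refine inv_eq_of_mul_eq_one_right ?_
  linear_combination 1 / 4 * h

theorem sum_twoCos_inv : ∑ u, (twoCos n u)⁻¹ = (-1) ^ n * (2 * n + 1) / 2 := by
  simp only [twoCos_inv, ← Finset.mul_sum, Finset.sum_add_distrib]
  rw [Finset.sum_comm]
  rw [Finset.sum_eq_zero (s := Finset.range n) fun r hr => ?_]
  · simp; ring
  · rw [← Finset.mul_sum, sum_twoCos, if_neg, mul_zero]
    exact two_mul_natCast_ne_zero r.succ_pos (by have := Finset.mem_range.1 hr; omega)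

theorem sum_twoCos_sq_inv : ∑ u, (twoCos n u ^ 2)⁻¹ = (2 * n + 1) ^ 2 / 4 := by
  simp only [twoCos_sq_inv, ← Finset.mul_sum, Finset.sum_add_distrib]
  rw [Finset.sum_comm]
  rw [Finset.sum_eq_zero (s := Finset.range n) fun r hr => ?_]
  · simp; ring
  · rw [← Finset.mul_sum, sum_twoCos, if_neg, mul_zero]
    exact two_mul_natCast_ne_zero r.succ_pos (by have := Finset.mem_range.1 hr; omega)

theorem sum_twoCos_mul {r s : ℕ} (hr : r < n) (hs : s < n) :
    ∑ u, twoCos n (2 * (r + 1 : ℕ) * u) * twoCos n (2 * (s + 1 : ℕ) * u) =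
      if r = s then (2 * (2 * n + 1) : ℂ) else 0 := by
  simp only [twoCos_mul, ← add_mul, ← sub_mul, Finset.sum_add_distrib, sum_twoCos]
  have h1 : (2 * (r + 1 : ℕ) + 2 * (s + 1 : ℕ) : ZMod (2 * n + 1)) ≠ 0 := by
    have := two_mul_natCast_ne_zero (n := n) (r := (r + 1) + (s + 1)) (by omega) (by omega)
    push_cast at this ⊢
    convert this using 1; ring
  rw [if_neg h1, zero_add]
  congr 1
  rw [← mul_sub, isUnit_two.mul_right_eq_zero, sub_eq_zero, ZMod.natCast_eq_natCast_iff',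
    Nat.mod_eq_of_lt (by omega), Nat.mod_eq_of_lt (by omega)]
  simp

theorem sum_odd_sq (n : ℕ) : ∑ r ∈ Finset.range n, ((2 * n + 1 : ℂ) - 2 * (r + 1 : ℕ)) ^ 2 =
    (n * (4 * n ^ 2 - 1) / 3 : ℂ) := by
  have h : ∀ m : ℕ, ∑ r ∈ Finset.range m, (2 * (r : ℂ) + 1) ^ 2 = (m * (4 * m ^ 2 - 1) / 3 : ℂ) := by
    intro m
    induction m with
    | zero => simp
    | succ m ih => rw [Finset.sum_range_succ, ih]; push_cast; ring
  rw [← h, ← Finset.sum_range_reflect (fun r : ℕ => (2 * (r : ℂ) + 1) ^ 2) n]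
  refine Finset.sum_congr rfl fun r hr => ?_
  have : ((n - 1 - r : ℕ) : ℂ) = n - 1 - r := by
    have := Finset.mem_range.1 hr
    rw [Nat.sub_sub, Nat.cast_sub (by omega)]; push_cast; ring
  push_cast
  rw [this]; ring

theorem sum_twoCos_pow_four_inv :
    ∑ u, (twoCos n u ^ 4)⁻¹ = (2 * n + 1) ^ 2 * ((2 * n + 1) ^ 2 + 2) / 48 := by
  set a : ℕ → ℂ := fun r => (-1) ^ (r + 1) * ((2 * n + 1) - 2 * (r + 1 : ℕ)) with ha
  set y : ℕ → ZMod (2 * n + 1) → ℂ := fun r u => twoCos n (2 * (r + 1 : ℕ) * u) with hy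
  have h1 : ∀ u, (twoCos n u ^ 4)⁻¹ = 1 / 16 * ((2 * n + 1) ^ 2 + 2 * (2 * n + 1) *
      ∑ r ∈ Finset.range n, a r * y r u +
      ∑ r ∈ Finset.range n, ∑ s ∈ Finset.range n, a r * a s * (y r u * y s u)) := fun u => by
    have h2 : ∑ r ∈ Finset.range n, ∑ s ∈ Finset.range n, a r * a s * (y r u * y s u) =
        (∑ r ∈ Finset.range n, a r * y r u) * ∑ r ∈ Finset.range n, a r * y r u := by
      rw [Finset.sum_mul_sum]
      exact Finset.sum_congr rfl fun r _ => Finset.sum_congr rfl fun s _ => by ring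
    rw [h2, show 4 = 2 * 2 from rfl, pow_mul, ← inv_pow, twoCos_sq_inv]
    ring
  have h3 : ∑ u, ∑ r ∈ Finset.range n, a r * y r u = 0 := by
    rw [Finset.sum_comm]
    refine Finset.sum_eq_zero fun r hr => ?_
    rw [← Finset.mul_sum, sum_twoCos, if_neg, mul_zero]
    exact two_mul_natCast_ne_zero r.succ_pos (by have := Finset.mem_range.1 hr; omega)
  have h4 : ∑ u, ∑ r ∈ Finset.range n, ∑ s ∈ Finset.range n, a r * a s * (y r u * y s u) =
      2 * (2 * n + 1) * (n * (4 * n ^ 2 - 1) / 3) := by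
    rw [Finset.sum_comm, ← sum_odd_sq, Finset.mul_sum]
    refine Finset.sum_congr rfl fun r hr => ?_
    rw [Finset.sum_comm]
    simp only [← Finset.mul_sum]
    rw [Finset.sum_congr rfl fun s hs => by
      rw [sum_twoCos_mul (Finset.mem_range.1 hr) (Finset.mem_range.1 hs)]]
    simp only [mul_ite, mul_zero, Finset.sum_ite_eq, hr, if_true, ha]
    have h5 : ((-1 : ℂ) ^ (r + 1)) * (-1) ^ (r + 1) = 1 := by rw [← mul_pow]; simp
    linear_combination (2 * (2 * n + 1) * ((2 * n + 1 : ℂ) - 2 * (r + 1 : ℕ)) ^ 2) * h5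
  simp only [h1, ← Finset.mul_sum, Finset.sum_add_distrib, h3, h4]
  simp
  ring

theorem isIntegral_stdAddChar (a : ZMod (2 * n + 1)) :
    IsIntegral ℤ (ZMod.stdAddChar a : ℂ) := by
  refine IsIntegral.of_pow (n := 2 * n + 1) (by omega) ?_
  rw [← AddChar.map_nsmul_eq_pow, nsmul_eq_mul, ZMod.natCast_self, zero_mul,
    AddChar.map_zero_eq_one]
  exact isIntegral_one

theorem isIntegral_twoCos_inv {a : ZMod (2 * n + 1)} (ha : a ≠ 0) :
    IsIntegral ℤ (twoCos n a)⁻¹ := by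
  set z : ℂ := ZMod.stdAddChar (2 * a) with hz
  have hz1 : z - 1 ≠ 0 := by
    rw [sub_ne_zero, hz, ← AddChar.map_zero_eq_one (ZMod.stdAddChar (N := 2 * n + 1)),
      ZMod.injective_stdAddChar.ne_iff]
    exact fun h => ha (isUnit_two.mul_right_eq_zero.1 h)
  have hzN : z ^ (2 * n + 1) = 1 := by
    rw [hz, ← AddChar.map_nsmul_eq_pow, nsmul_eq_mul, ZMod.natCast_self, zero_mul,
      AddChar.map_zero_eq_one]
  have hgeom := mul_geom_sum (z ^ 2) (n + 1)
  have h1 : (1 + z) * ∑ k ∈ Finset.range (n + 1), (z ^ 2) ^ k = 1 := by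
    apply mul_left_cancel₀ hz1
    have : (z ^ 2) ^ (n + 1) = z := by
      rw [← pow_mul, show 2 * (n + 1) = 2 * n + 1 + 1 by ring, pow_succ, hzN, one_mul]
    rw [this] at hgeom
    linear_combination hgeom
  have h2 : ZMod.stdAddChar a * twoCos n a = 1 + z := by
    have h4 : 2 * a = a + a := two_mul a
    rw [twoCos, mul_add, ← AddChar.map_add_eq_mul, ← AddChar.map_add_eq_mul, add_neg_cancel,
      AddChar.map_zero_eq_one, hz, h4, add_comm]
  have h3 : (twoCos n a)⁻¹ = ZMod.stdAddChar a * ∑ k ∈ Finset.range (n + 1), (z ^ 2) ^ k := by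
    refine inv_eq_of_mul_eq_one_right ?_
    linear_combination h1 + (∑ k ∈ Finset.range (n + 1), (z ^ 2) ^ k) * h2
  rw [h3]
  exact (isIntegral_stdAddChar a).mul
    (IsIntegral.sum _ fun k _ => ((isIntegral_stdAddChar _).pow 2).pow k)

theorem twoCos_natCast (k : ℕ) :
    twoCos n k = ((2 * Real.cos (2 * Real.pi * k / (2 * n + 1)) : ℝ) : ℂ) := by
  have h1 := ZMod.stdAddChar_coe (N := 2 * n + 1) k
  have h2 := ZMod.stdAddChar_coe (N := 2 * n + 1) (-k)
  rw [twoCos]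
  push_cast at h1 h2 ⊢
  rw [h1, h2, Complex.two_cos]
  congr 2 <;> ring

end TwoCos

/-- A product over `ZMod (2 * n + 1)` of an even function. -/
@[to_additive /-- A sum over `ZMod (2 * n + 1)` of an even function. -/]
theorem prod_zmod_of_even {M : Type*} [CommMonoid M] (n : ℕ) (g : ZMod (2 * n + 1) → M)
    (hg : ∀ a, g (-a) = g a) :
    ∏ a, g a = (∏ i : Fin n, g ((i + 1 : ℕ) : ZMod (2 * n + 1))) ^ 2 * g 0 := by
  have h1 : ∏ a, g a = ∏ m ∈ Finset.range (2 * n + 1), g (m : ZMod (2 * n + 1)) := by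
    rw [← Fin.prod_univ_eq_prod_range (fun m => g (m : ZMod (2 * n + 1)))]
    exact Finset.prod_congr rfl fun a _ => congrArg g (ZMod.natCast_zmod_val a).symm
  rw [h1, Finset.prod_range_succ', Nat.cast_zero]
  congr 1
  rw [prod_range_two_mul_of_symm n (fun m => g ((m + 1 : ℕ) : ZMod (2 * n + 1))) fun k hk => ?_]
  · rw [Fin.prod_univ_eq_prod_range (fun m => g ((m + 1 : ℕ) : ZMod (2 * n + 1)))]
  · rw [← hg]
    congr 1
    have h2 : ((n + k + 1 + (n - 1 - k + 1) : ℕ) : ZMod (2 * n + 1)) = 0 := by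
      rw [show n + k + 1 + (n - 1 - k + 1) = 2 * n + 1 by omega, ZMod.natCast_self]
    rw [Nat.cast_add] at h2
    linear_combination -h2

/-- The `n` values `2 cos (2 π (i + 1) / (2 n + 1))`. -/
noncomputable def twoCosRoot (n : ℕ) (i : Fin n) : ℂ := twoCos n ((i + 1 : ℕ) : ZMod (2 * n + 1))

/-- The power sums of the inverses of the pairwise sums of the `twoCosRoot`s. -/
noncomputable def pairSum (n k : ℕ) : ℂ :=
  ∑ i : Fin n, ∑ j ∈ Finset.Ioi i, ((twoCosRoot n i + twoCosRoot n j) ^ k)⁻¹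

theorem sum_add_inv_pow (n k : ℕ) :
    ∑ a, ∑ b, ((twoCos n a + twoCos n b) ^ k)⁻¹ = (∑ u, (twoCos n u ^ k)⁻¹) ^ 2 := by
  have hinj : Function.Injective
      fun p : ZMod (2 * n + 1) × ZMod (2 * n + 1) => (p.1 + p.2, p.1 - p.2) := by
    rintro ⟨a, b⟩ ⟨c, d⟩ h
    simp only [Prod.mk.injEq] at h
    obtain ⟨h1, h2⟩ := h
    ext
    · exact isUnit_two.mul_left_cancel (by linear_combination h1 + h2)
    · exact isUnit_two.mul_left_cancel (by linear_combination h1 - h2)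
  have hbij := Finite.injective_iff_bijective.1 hinj
  rw [← Fintype.sum_prod_type' fun a b => ((twoCos n a + twoCos n b) ^ k)⁻¹,
    ← (Equiv.ofBijective _ hbij).sum_comp, sq, Finset.sum_mul_sum, ← Fintype.sum_prod_type']
  refine Finset.sum_congr rfl fun p _ => ?_
  rw [← mul_inv, ← mul_pow, twoCos_mul]
  rfl

theorem sum_add_two_inv_pow (n k : ℕ) :
    ∑ a, ((twoCos n a + 2) ^ k)⁻¹ = ∑ u, (twoCos n u ^ (2 * k))⁻¹ := by
  have hbij : Function.Bijective fun a : ZMod (2 * n + 1) => 2 * a :=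
    Finite.injective_iff_bijective.1 fun a b h => isUnit_two.mul_left_cancel h
  rw [← (Equiv.ofBijective _ hbij).sum_comp]
  refine Finset.sum_congr rfl fun u _ => ?_
  rw [pow_mul, ← twoCos_two_mul]
  rfl

theorem sum_twoCos_inv_pow_sq (n k : ℕ) :
    (∑ u, (twoCos n u ^ k)⁻¹) ^ 2 = (4 ^ k)⁻¹ + 2 * (∑ u, (twoCos n u ^ (2 * k))⁻¹ - (4 ^ k)⁻¹) +
      2 * (2 ^ k)⁻¹ * (∑ u, (twoCos n u ^ k)⁻¹ - (2 ^ k)⁻¹) + 8 * pairSum n k := by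
  have h1 := sum_add_inv_pow n k
  rw [sum_zmod_of_even n _ fun a => by simp only [twoCos_neg]] at h1
  have h0 := sum_add_two_inv_pow n k
  rw [sum_zmod_of_even n _ fun a => by simp only [twoCos_neg]] at h0
  have h2 := sum_zmod_of_even n (fun u => (twoCos n u ^ k)⁻¹) fun a => by simp only [twoCos_neg]
  have hrow : ∀ a, ∑ b, ((twoCos n a + twoCos n b) ^ k)⁻¹ =
      2 • ∑ j : Fin n, ((twoCos n a + twoCosRoot n j) ^ k)⁻¹ + ((twoCos n a + 2) ^ k)⁻¹ := fun a => by
    rw [sum_zmod_of_even n _ fun a => by simp only [twoCos_neg], twoCos_zero]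
    rfl
  simp only [hrow, twoCos_zero, Finset.sum_add_distrib] at h1 h0 h2
  change 2 • (∑ i : Fin n, (2 • ∑ j : Fin n, ((twoCosRoot n i + twoCosRoot n j) ^ k)⁻¹) +
    ∑ i : Fin n, ((twoCosRoot n i + 2) ^ k)⁻¹) + _ = _ at h1
  change 2 • ∑ i : Fin n, ((twoCosRoot n i + 2) ^ k)⁻¹ + _ = _ at h0
  rw [← Finset.smul_sum, sum_sum_eq_diag_add_sum_Ioi] at h1
  have hsymm : ∑ i : Fin n, ∑ j ∈ Finset.Ioi i, (((twoCosRoot n i + twoCosRoot n j) ^ k)⁻¹ +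
      ((twoCosRoot n j + twoCosRoot n i) ^ k)⁻¹) = 2 * pairSum n k := by
    simp only [pairSum, Finset.mul_sum]
    refine Finset.sum_congr rfl fun i _ => Finset.sum_congr rfl fun j _ => ?_
    rw [add_comm (twoCosRoot n j)]; ring
  have hdiag : ∑ i : Fin n, ((twoCosRoot n i + twoCosRoot n i) ^ k)⁻¹ =
      (2 ^ k)⁻¹ * ∑ i : Fin n, (twoCosRoot n i ^ k)⁻¹ := by
    rw [Finset.mul_sum]
    refine Finset.sum_congr rfl fun i _ => ?_
    rw [← two_mul, mul_pow, mul_inv]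
  have hcomm : ∑ a, ((2 + twoCos n a) ^ k)⁻¹ = ∑ u, (twoCos n u ^ (2 * k))⁻¹ := by
    simpa only [add_comm] using sum_add_two_inv_pow n k
  have h22 : (2 + 2 : ℂ) = 4 := by norm_num
  change _ = 2 • ∑ i : Fin n, (twoCosRoot n i ^ k)⁻¹ + _ at h2
  rw [hsymm, hdiag, hcomm] at h1
  rw [h22] at h0
  simp only [nsmul_eq_mul, Nat.cast_ofNat] at h0 h1 h2
  linear_combination -h1 + h0 - 2 * (2 ^ k)⁻¹ * h2

theorem pairSum_one (n : ℕ) :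
    pairSum n 1 = -(((n / 2 : ℕ) : ℂ) * ((n / 2 : ℕ) + 1) / 2) := by
  have h := sum_twoCos_inv_pow_sq n 1
  simp only [pow_one, mul_one, sum_twoCos_inv, sum_twoCos_sq_inv] at h
  rcases Nat.even_or_odd' n with ⟨m, hm | hm⟩
  · have h2 : n / 2 = m := by omega
    have h3 : (-1 : ℂ) ^ n = 1 := Even.neg_one_pow ⟨m, by omega⟩
    have h4 : (n : ℂ) = 2 * m := by rw [hm]; push_cast; ring
    rw [h3, h4] at h
    rw [h2]
    linear_combination -(1 / 8) * h
  · have h2 : n / 2 = m := by omega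
    have h3 : (-1 : ℂ) ^ n = -1 := Odd.neg_one_pow ⟨m, by omega⟩
    have h4 : (n : ℂ) = 2 * m + 1 := by rw [hm]; push_cast; ring
    rw [h3, h4] at h
    rw [h2]
    linear_combination -(1 / 8) * h

theorem pairSum_two (n : ℕ) : pairSum n 2 = ((n + 2).choose 4 : ℕ) := by
  have h := sum_twoCos_inv_pow_sq n 2
  simp only [show 2 * 2 = 4 from rfl, sum_twoCos_pow_four_inv, sum_twoCos_sq_inv] at h
  have h1 : (((n + 2).choose 4 : ℕ) : ℂ) * 24 = (n - 1) * n * (n + 1) * (n + 2) := by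
    have h2 := Nat.descFactorial_eq_factorial_mul_choose (n + 2) 4
    rcases n with _ | n
    · simp [Nat.choose]
    · have h3 : (n + 1 + 2).descFactorial 4 = n * (n + 1) * (n + 2) * (n + 3) := by
        simp only [Nat.descFactorial, Nat.sub_zero, mul_one]
        rw [show n + 1 + 2 - 3 = n by omega, show n + 1 + 2 - 2 = n + 1 by omega,
          show n + 1 + 2 - 1 = n + 2 by omega]
        ring
      rw [h3] at h2
      have h4 := congrArg (Nat.cast : ℕ → ℂ) h2
      rw [show Nat.factorial 4 = 24 from rfl] at h4
      push_cast at h4 ⊢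
      linear_combination -h4
  linear_combination -(1 / 8) * h - (1 / 24) * h1

open Polynomial in
/-- For `n` distinct roots `v i` of a monic integer polynomial of degree `n`, the product of the
numbers `v i + v j + 2 c` over the unordered pairs is an integer. -/
theorem exists_int_eq_prod_pair_add {n : ℕ} {q : ℤ[X]} (hq : q.Monic) (hdeg : q.natDegree = n)
    {v : Fin n → ℂ} (hv : Function.Injective v) (hroot : ∀ i, aeval (v i) q = 0) (c : ℤ) :
    ∃ b : ℤ, ∏ i, ∏ j ∈ Finset.Ioi i, (v i + v j + 2 * c) = b := by
  rcases Nat.eq_zero_or_pos n with rfl | hn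
  · exact ⟨1, by simp⟩
  set p : ℕ → ℤ[X] := fun k => ((X + C c) ^ 2) ^ k %ₘ q with hp
  have hpdeg : ∀ k, (p k).natDegree < n := fun k => by
    rw [← hdeg]
    exact natDegree_modByMonic_lt _ hq fun h => by rw [h, natDegree_one] at hdeg; omega
  set R : Matrix (Fin n) (Fin n) ℤ := Matrix.of fun l k => (p k).coeff l with hR
  have hmul : Matrix.vandermonde (fun i => (v i + c) ^ 2) =
      Matrix.vandermonde v * R.map (Int.cast : ℤ → ℂ) := by
    ext i k
    have h1 : aeval (v i) (p k) = ((v i + c) ^ 2) ^ (k : ℕ) := by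
      rw [hp, aeval_modByMonic_eq_self_of_root (hroot i)]
      simp
    rw [Matrix.vandermonde_apply, ← h1, aeval_eq_sum_range' (hpdeg k), Matrix.mul_apply,
      ← Fin.sum_univ_eq_sum_range (fun l => (p k).coeff l • v i ^ l)]
    refine Finset.sum_congr rfl fun l _ => ?_
    rw [zsmul_eq_mul, mul_comm]
    rfl
  have hdet := congrArg Matrix.det hmul
  rw [Matrix.det_mul, Matrix.det_vandermonde] at hdet
  have hfac : ∏ i : Fin n, ∏ j ∈ Finset.Ioi i, ((v j + c) ^ 2 - (v i + c) ^ 2) =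
      (Matrix.vandermonde v).det * ∏ i, ∏ j ∈ Finset.Ioi i, (v i + v j + 2 * c) := by
    rw [Matrix.det_vandermonde]
    simp only [← Finset.prod_mul_distrib]
    exact Finset.prod_congr rfl fun i _ => Finset.prod_congr rfl fun j _ => by ring
  rw [hfac] at hdet
  refine ⟨R.det, ?_⟩
  rw [mul_left_cancel₀ (Matrix.det_vandermonde_ne_zero_iff.2 hv) hdet, Int.cast_det]

open Polynomial in
/-- The monic polynomial of degree `n` with the roots `2 cos (2 π k / (2 n + 1))`. -/
noncomputable def twoCosPoly : ℕ → ℤ[X]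
  | 0 => 1
  | 1 => X + 1
  | n + 2 => X * twoCosPoly (n + 1) - twoCosPoly n

open Polynomial in
theorem twoCosPoly_monic_natDegree (n : ℕ) :
    ((twoCosPoly n).Monic ∧ (twoCosPoly n).natDegree = n) ∧
      ((twoCosPoly (n + 1)).Monic ∧ (twoCosPoly (n + 1)).natDegree = n + 1) := by
  induction n with
  | zero =>
    refine ⟨⟨monic_one, natDegree_one⟩, monic_X_add_C 1, natDegree_X_add_C 1⟩
  | succ n ih =>
    obtain ⟨⟨h1, h2⟩, h3, h4⟩ := ih
    refine ⟨⟨h3, h4⟩, ?_⟩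
    have h5 : (X * twoCosPoly (n + 1)).Monic := monic_X.mul h3
    have h6 : (X * twoCosPoly (n + 1)).natDegree = n + 2 := by
      rw [monic_X.natDegree_mul h3, natDegree_X, h4]; ring
    have h7 : (twoCosPoly n).degree < (X * twoCosPoly (n + 1)).degree :=
      degree_lt_degree (by omega)
    rw [twoCosPoly]
    refine ⟨h5.sub_of_left h7, ?_⟩
    rw [natDegree_sub_eq_left_of_natDegree_lt (by omega), h6]

open Polynomial in
theorem aeval_twoCosPoly {z w : ℂ} (hzw : z * w = 1) (m : ℕ) :
    aeval (z + w) (twoCosPoly m) * z ^ m * (z - 1) = z ^ (2 * m + 1) - 1 ∧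
    aeval (z + w) (twoCosPoly (m + 1)) * z ^ (m + 1) * (z - 1) = z ^ (2 * (m + 1) + 1) - 1 := by
  induction m with
  | zero =>
    simp only [twoCosPoly, map_one, map_add, aeval_X]
    refine ⟨by ring, ?_⟩
    linear_combination (z - 1) * hzw
  | succ m ih =>
    refine ⟨ih.2, ?_⟩
    rw [twoCosPoly, map_sub, map_mul, aeval_X]
    linear_combination (z ^ 2 + 1) * ih.2 - z ^ 2 * ih.1 +
      (aeval (z + w) (twoCosPoly (m + 1)) * z ^ (m + 1) * (z - 1)) * hzw

section Roots

variable {n : ℕ}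

theorem natCast_succ_ne_zero (i : Fin n) : ((i + 1 : ℕ) : ZMod (2 * n + 1)) ≠ 0 := fun h => by
  rw [ZMod.natCast_eq_zero_iff] at h
  have := Nat.le_of_dvd (Nat.succ_pos _) h
  omega

theorem aeval_twoCosRoot (i : Fin n) : Polynomial.aeval (twoCosRoot n i) (twoCosPoly n) = 0 := by
  set a : ZMod (2 * n + 1) := ((i + 1 : ℕ) : ZMod (2 * n + 1)) with ha
  have h1 : (ZMod.stdAddChar a : ℂ) * ZMod.stdAddChar (-a) = 1 := by
    rw [← AddChar.map_add_eq_mul, add_neg_cancel, AddChar.map_zero_eq_one]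
  have h2 := (aeval_twoCosPoly h1 n).1
  have hzN : (ZMod.stdAddChar a : ℂ) ^ (2 * n + 1) = 1 := by
    rw [← AddChar.map_nsmul_eq_pow, nsmul_eq_mul, ZMod.natCast_self, zero_mul,
      AddChar.map_zero_eq_one]
  have hz1 : (ZMod.stdAddChar a : ℂ) - 1 ≠ 0 := by
    rw [sub_ne_zero, ← AddChar.map_zero_eq_one (ZMod.stdAddChar (N := 2 * n + 1)),
      ZMod.injective_stdAddChar.ne_iff]
    exact natCast_succ_ne_zero i
  rw [hzN, sub_self] at h2
  have hz0 : (ZMod.stdAddChar a : ℂ) ≠ 0 := left_ne_zero_of_mul_eq_one h1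
  rcases mul_eq_zero.1 h2 with h3 | h3
  · exact (mul_eq_zero.1 h3).resolve_right (pow_ne_zero _ hz0)
  · exact absurd h3 hz1

/-- The real number `2 cos (2 π (i + 1) / (2 n + 1))`. -/
noncomputable def realRoot (n i : ℕ) : ℝ := 2 * Real.cos (2 * Real.pi * (i + 1) / (2 * n + 1))

theorem twoCosRoot_eq (i : Fin n) : twoCosRoot n i = (realRoot n i : ℝ) := by
  rw [twoCosRoot, twoCos_natCast, realRoot]; push_cast; rfl

theorem gridEigen_eq (k : ℕ) : gridEigen n k = realRoot n k + 2 := by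
  rw [gridEigen, realRoot, Real.cos_sq]
  have : 2 * (Real.pi * (k + 1) / (2 * n + 1)) = 2 * Real.pi * (k + 1) / (2 * n + 1) := by ring
  rw [this]; ring

theorem realRoot_add (i j : ℕ) : realRoot n i + realRoot n j =
    4 * Real.cos (Real.pi * (i + j + 2) / (2 * n + 1)) *
      Real.cos (Real.pi * (i - j) / (2 * n + 1)) := by
  have h1 : 2 * Real.pi * (i + 1) / (2 * n + 1) = Real.pi * (i + j + 2) / (2 * n + 1) +
      Real.pi * (i - j) / (2 * n + 1) := by field_simp; ring
  have h2 : 2 * Real.pi * (j + 1) / (2 * n + 1) = Real.pi * (i + j + 2) / (2 * n + 1) -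
      Real.pi * (i - j) / (2 * n + 1) := by field_simp; ring
  rw [realRoot, realRoot, h1, h2, Real.cos_add, Real.cos_sub]; ring

theorem sign_mul_realRoot_add_pos {i j : ℕ} (hij : i < j) (hj : j < n) :
    0 < (if n ≤ i + j + 1 then -1 else 1) * (realRoot n i + realRoot n j) := by
  have hπ := Real.pi_pos
  have hi' : (i : ℝ) + 1 ≤ j := by exact_mod_cast hij
  have hj' : (j : ℝ) + 1 ≤ n := by exact_mod_cast hj
  have hi0 : (0 : ℝ) ≤ i := Nat.cast_nonneg i
  have hN : (0 : ℝ) < 2 * n + 1 := by positivity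
  have hdiff : 0 < Real.cos (Real.pi * (i - j) / (2 * n + 1)) := by
    apply Real.cos_pos_of_mem_Ioo
    constructor
    · rw [lt_div_iff₀ hN]; nlinarith
    · rw [div_lt_iff₀ hN]; nlinarith
  rw [realRoot_add]
  split_ifs with h
  · have h' : (n : ℝ) ≤ i + j + 1 := by exact_mod_cast h
    have hsum : Real.cos (Real.pi * (i + j + 2) / (2 * n + 1)) < 0 := by
      apply Real.cos_neg_of_pi_div_two_lt_of_lt
      · rw [lt_div_iff₀ hN]; nlinarith
      · rw [div_lt_iff₀ hN]; nlinarith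
    nlinarith [mul_pos_of_neg_of_neg hsum (neg_lt_zero.2 hdiff)]
  · have h' : (i : ℝ) + j + 2 ≤ n := by
      have : i + j + 2 ≤ n := by omega
      exact_mod_cast this
    have hsum : 0 < Real.cos (Real.pi * (i + j + 2) / (2 * n + 1)) := by
      apply Real.cos_pos_of_mem_Ioo
      constructor
      · have : 0 < Real.pi * (i + j + 2) / (2 * n + 1) := by positivity
        linarith
      · rw [div_lt_iff₀ hN]; nlinarith
    positivity

theorem twoCosRoot_injective (n : ℕ) : Function.Injective (twoCosRoot n) := by
  have hmem : ∀ k : Fin n, 2 * Real.pi * (k + 1) / (2 * n + 1) ∈ Set.Icc 0 Real.pi := fun k => by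
    have hπ := Real.pi_pos
    have hk : ((k : ℕ) : ℝ) + 1 ≤ n := by exact_mod_cast k.2
    constructor
    · positivity
    · rw [div_le_iff₀ (by positivity)]; nlinarith
  intro i j h
  rw [twoCosRoot_eq, twoCosRoot_eq] at h
  have h1 := mul_left_cancel₀ two_ne_zero (Complex.ofReal_injective h)
  have h2 := Real.injOn_cos (hmem i) (hmem j) h1
  have hπ := Real.pi_pos.ne'
  field_simp at h2
  ext
  have h5 : ((i : ℕ) : ℝ) = (j : ℕ) := by linarith
  exact_mod_cast h5

theorem exists_int_eq_prod_twoCosRoot (n : ℕ) (c : ℤ) :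
    ∃ b : ℤ, ∏ i, ∏ j ∈ Finset.Ioi i, (twoCosRoot n i + twoCosRoot n j + 2 * c) = b :=
  exists_int_eq_prod_pair_add (twoCosPoly_monic_natDegree n).1.1 (twoCosPoly_monic_natDegree n).1.2
    (twoCosRoot_injective n) aeval_twoCosRoot c

theorem isIntegral_twoCos_add_inv {a b : ZMod (2 * n + 1)} (h1 : a + b ≠ 0) (h2 : a - b ≠ 0) :
    IsIntegral ℤ (twoCos n a + twoCos n b)⁻¹ ∧ twoCos n a + twoCos n b ≠ 0 := by
  obtain ⟨h, hh⟩ := (isUnit_two (n := n)).exists_right_inv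
  have e1 : a = h * (a + b) + h * (a - b) := by linear_combination -a * hh
  have e2 : b = h * (a + b) - h * (a - b) := by linear_combination -b * hh
  have hu : ∀ c, c ≠ 0 → h * c ≠ 0 := fun c hc h0 => hc (by linear_combination 2 * h0 - c * hh)
  have h3 : twoCos n a + twoCos n b = twoCos n (h * (a + b)) * twoCos n (h * (a - b)) := by
    rw [twoCos_mul, ← e1, ← e2]
  rw [h3, mul_inv]
  exact ⟨(isIntegral_twoCos_inv (hu _ h1)).mul (isIntegral_twoCos_inv (hu _ h2)),
    mul_ne_zero (twoCos_ne_zero _) (twoCos_ne_zero _)⟩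

theorem isIntegral_twoCosRoot_add_inv {i j : Fin n} (hij : i < j) :
    IsIntegral ℤ (twoCosRoot n i + twoCosRoot n j)⁻¹ ∧ twoCosRoot n i + twoCosRoot n j ≠ 0 := by
  have hij' : (i : ℕ) < j := hij
  apply isIntegral_twoCos_add_inv
  · rw [← Nat.cast_add, Ne, ZMod.natCast_eq_zero_iff]
    intro h
    have := Nat.le_of_dvd (by omega) h
    omega
  · rw [sub_ne_zero, Ne, ZMod.natCast_eq_natCast_iff', Nat.mod_eq_of_lt (by omega),
      Nat.mod_eq_of_lt (by omega)]
    omega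

theorem exists_int_of_isIntegral_ratCast {r : ℚ} (h : IsIntegral ℤ (r : ℂ)) : ∃ k : ℤ, (k : ℚ) = r := by
  have h1 : IsIntegral ℤ r := by
    have : (r : ℂ) = algebraMap ℚ ℂ r := by simp
    rw [this] at h
    exact (isIntegral_algebraMap_iff (algebraMap ℚ ℂ).injective).1 h
  simpa using IsIntegrallyClosed.isIntegral_iff.1 h1

end Roots

theorem prod_twoCos (n : ℕ) : ∏ u, twoCos n u = 2 := by
  set e : AddChar (ZMod (2 * n + 1)) ℂ := ZMod.stdAddChar with he
  set s : ZMod (2 * n + 1) → ℂ := fun u => if u = 0 then 1 else e u - e (-u) with hs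
  have hs0 : ∀ u, s u ≠ 0 := fun u => by
    simp only [hs]
    split_ifs with h
    · exact one_ne_zero
    · rw [sub_ne_zero, he, ZMod.injective_stdAddChar.ne_iff]
      intro h1
      exact h (isUnit_two.mul_right_eq_zero.1 (by linear_combination h1))
  have hbij : Function.Bijective fun a : ZMod (2 * n + 1) => 2 * a :=
    Finite.injective_iff_bijective.1 fun a b h => isUnit_two.mul_left_cancel h
  have h1 : ∏ u, s (2 * u) = ∏ u, s u := (Equiv.ofBijective _ hbij).prod_comp s
  have h2 : ∀ u, s (2 * u) * (if u = 0 then 2 else 1) = s u * twoCos n u := fun u => by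
    simp only [hs, isUnit_two.mul_right_eq_zero]
    split_ifs with h
    · rw [h, twoCos_zero]
    · have h3 : 2 * u = u + u := two_mul u
      rw [twoCos, h3, neg_add, AddChar.map_add_eq_mul, AddChar.map_add_eq_mul]
      ring
  have h3 : (∏ u, s u) * 2 = (∏ u, s u) * ∏ u, twoCos n u := by
    rw [← Finset.prod_mul_distrib, ← Finset.prod_congr rfl fun u _ => h2 u,
      Finset.prod_mul_distrib, h1, Finset.prod_ite_eq' Finset.univ 0]
    simp
  exact (mul_left_cancel₀ (Finset.prod_ne_zero_iff.2 fun u _ => hs0 u) h3).symm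

theorem prod_gridEigen (n : ℕ) : ∏ i : Fin n, gridEigen n i = 1 := by
  have hbij : Function.Bijective fun a : ZMod (2 * n + 1) => 2 * a :=
    Finite.injective_iff_bijective.1 fun a b h => isUnit_two.mul_left_cancel h
  have h1 : ∏ a, (twoCos n a + 2) = 4 := by
    rw [← (Equiv.ofBijective _ hbij).prod_comp]
    have : ∀ u, twoCos n (Equiv.ofBijective _ hbij u) + 2 = twoCos n u ^ 2 := twoCos_two_mul
    simp only [this, Finset.prod_pow, prod_twoCos]
    norm_num
  rw [prod_zmod_of_even n _ fun a => by rw [twoCos_neg], twoCos_zero] at h1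
  have h2 : (∏ i : Fin n, gridEigen n i) ^ 2 = 1 := by
    apply Complex.ofReal_injective
    push_cast
    have h3 : ∀ i : Fin n, ((gridEigen n i : ℝ) : ℂ) = twoCos n ((i + 1 : ℕ)) + 2 := fun i => by
      rw [gridEigen_eq, Complex.ofReal_add, ← twoCosRoot_eq]; rfl
    simp only [h3]
    push_cast at h1 ⊢
    linear_combination (1 / 4) * h1
  exact (pow_eq_one_iff_of_nonneg (Finset.prod_nonneg fun i _ => (gridEigen_pos i.2).le)
    two_ne_zero).1 h2

/-- The positive square root of the number of tilings divided by `2 ^ n`. -/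
noncomputable def gridPairProd (n : ℕ) : ℝ :=
  ∏ i : Fin n, ∏ j ∈ Finset.Ioi i, (gridEigen n i + gridEigen n j)

theorem gridPairProd_pos (n : ℕ) : 0 < gridPairProd n :=
  Finset.prod_pos fun i _ => Finset.prod_pos fun j _ =>
    add_pos (gridEigen_pos i.2) (gridEigen_pos j.2)

theorem dimerCount_eq (n : ℕ) : (dimerCount n : ℝ) = 2 ^ n * gridPairProd n ^ 2 := by
  have h1 : (dimerCount n : ℝ) = ∏ i : Fin n, ∏ j : Fin n, (gridEigen n i + gridEigen n j) := by
    rw [dimerCount_eq_prod, ← Fin.prod_univ_eq_prod_range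
      (fun k => ∏ l ∈ Finset.range n, (gridEigen n k + gridEigen n l))]
    refine Finset.prod_congr rfl fun i _ => ?_
    rw [← Fin.prod_univ_eq_prod_range (fun l => gridEigen n i + gridEigen n l)]
  rw [h1, prod_prod_eq_diag_mul_prod_Ioi, gridPairProd]
  have h2 : ∏ i : Fin n, (gridEigen n i + gridEigen n i) = 2 ^ n := by
    simp only [← two_mul, Finset.prod_mul_distrib, prod_gridEigen, Finset.prod_const,
      Finset.card_univ, Fintype.card_fin, mul_one]
  rw [h2]
  simp only [← Finset.prod_pow]
  congr 1
  exact Finset.prod_congr rfl fun i _ => Finset.prod_congr rfl fun j _ => by ring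

theorem gridPairProd_cast (n : ℕ) : (gridPairProd n : ℂ) =
    ∏ i, ∏ j ∈ Finset.Ioi i, (twoCosRoot n i + twoCosRoot n j + 4) := by
  rw [gridPairProd]
  push_cast
  refine Finset.prod_congr rfl fun i _ => Finset.prod_congr rfl fun j _ => ?_
  rw [twoCosRoot_eq, twoCosRoot_eq, gridEigen_eq, gridEigen_eq]
  push_cast; ring

theorem prod_ite_neg_one_range {n j : ℕ} (hj : j < n) :
    ∏ i ∈ Finset.range j, (if n ≤ i + j + 1 then (-1 : ℤ) else 1) = (-1) ^ (2 * j + 1 - n) := by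
  rw [Finset.prod_ite, Finset.prod_const_one, mul_one, Finset.prod_const]
  congr 1
  have : (Finset.range j).filter (fun i => n ≤ i + j + 1) = Finset.Ico (n - 1 - j) j := by
    ext i; simp only [Finset.mem_filter, Finset.mem_range, Finset.mem_Ico]; omega
  rw [this, Nat.card_Ico]; omega

theorem sum_two_mul_add_one_tsub (n : ℕ) :
    ∑ j ∈ Finset.range n, (2 * j + 1 - n) = n ^ 2 / 4 := by
  rcases Nat.even_or_odd' n with ⟨m, hm | hm⟩
  · have h1 : n ^ 2 / 4 = m ^ 2 := by
      rw [hm, show (2 * m) ^ 2 = 4 * m ^ 2 by ring]; omega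
    have h2 : ∀ k, ∑ t ∈ Finset.range k, (2 * t + 1) = k ^ 2 := fun k => by
      induction k with
      | zero => rfl
      | succ k ih => rw [Finset.sum_range_succ, ih]; ring
    rw [h1, ← h2 m, hm, two_mul, Finset.sum_range_add, Finset.sum_eq_zero, zero_add]
    · exact Finset.sum_congr rfl fun t _ => by omega
    · intro j hj; have := Finset.mem_range.1 hj; omega
  · have h1 : n ^ 2 / 4 = m * (m + 1) := by
      rw [hm, show (2 * m + 1) ^ 2 = 4 * (m * (m + 1)) + 1 by ring]; omega
    have h2 : ∀ k, ∑ t ∈ Finset.range (k + 1), 2 * t = k * (k + 1) := fun k => by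
      induction k with
      | zero => rfl
      | succ k ih => rw [Finset.sum_range_succ, ih]; ring
    rw [h1, ← h2 m, hm, show 2 * m + 1 = m + (m + 1) by ring, Finset.sum_range_add,
      Finset.sum_eq_zero, zero_add]
    · exact Finset.sum_congr rfl fun t _ => by omega
    · intro j hj; have := Finset.mem_range.1 hj; omega

theorem prod_prod_ite_neg_one (n : ℕ) :
    ∏ i : Fin n, ∏ j ∈ Finset.Ioi i, (if n ≤ (i : ℕ) + j + 1 then (-1 : ℤ) else 1) =
      (-1) ^ (n ^ 2 / 4) := by
  rw [Finset.prod_comm' (t' := Finset.univ) (s' := fun j => Finset.Iio j) (by simp),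
    ← sum_two_mul_add_one_tsub, ← Finset.prod_pow_eq_pow_sum,
    ← Fin.prod_univ_eq_prod_range (fun j => (-1 : ℤ) ^ (2 * j + 1 - n))]
  refine Finset.prod_congr rfl fun j _ => ?_
  rw [← prod_ite_neg_one_range j.2, ← Nat.Iio_eq_range, ← Fin.map_valEmbedding_Iio,
    Finset.prod_map]
  rfl

/-- The product of the pairwise sums of the roots is a unit, with an explicit sign. -/
theorem prod_twoCosRoot_add (n : ℕ) : ∏ i, ∏ j ∈ Finset.Ioi i, (twoCosRoot n i + twoCosRoot n j) =
    (-1) ^ (n ^ 2 / 4) := by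
  obtain ⟨b, hb⟩ := exists_int_eq_prod_twoCosRoot n 0
  simp only [Int.cast_zero, mul_zero, add_zero] at hb
  have hinv : IsIntegral ℤ (((b : ℚ)⁻¹ : ℚ) : ℂ) := by
    rw [Rat.cast_inv, Rat.cast_intCast, ← hb]
    simp only [← Finset.prod_inv_distrib]
    exact IsIntegral.prod _ fun i _ => IsIntegral.prod _ fun j hj =>
      (isIntegral_twoCosRoot_add_inv (Finset.mem_Ioi.1 hj)).1
  have hb0 : b ≠ 0 := fun h => by
    rw [h, Int.cast_zero, Finset.prod_eq_zero_iff] at hb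
    obtain ⟨i, _, hi⟩ := hb
    obtain ⟨j, hj, hij⟩ := Finset.prod_eq_zero_iff.1 hi
    exact (isIntegral_twoCosRoot_add_inv (Finset.mem_Ioi.1 hj)).2 hij
  obtain ⟨k, hk⟩ := exists_int_of_isIntegral_ratCast hinv
  have hbk : b * k = 1 := by
    have hb0' : (b : ℚ) ≠ 0 := Int.cast_ne_zero.2 hb0
    have : (b : ℚ) * k = 1 := by rw [hk, mul_inv_cancel₀ hb0']
    exact_mod_cast this
  have hreal : ∏ i : Fin n, ∏ j ∈ Finset.Ioi i, (realRoot n i + realRoot n j) = b := by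
    apply Complex.ofReal_injective
    push_cast
    simp only [← twoCosRoot_eq, hb]
  have hpos : 0 < (((-1) ^ (n ^ 2 / 4) * b : ℤ) : ℝ) := by
    rw [← prod_prod_ite_neg_one]
    push_cast
    rw [← hreal]
    simp only [← Finset.prod_mul_distrib]
    exact Finset.prod_pos fun i _ => Finset.prod_pos fun j hj =>
      sign_mul_realRoot_add_pos (Fin.lt_def.1 (Finset.mem_Ioi.1 hj)) j.2
  have hpos' : 0 < (-1) ^ (n ^ 2 / 4) * b := by exact_mod_cast hpos
  have hfin : b = (-1) ^ (n ^ 2 / 4) := by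
    rcases Int.eq_one_or_neg_one_of_mul_eq_one hbk with h | h <;>
    rcases neg_one_pow_eq_or ℤ (n ^ 2 / 4) with h' | h' <;> rw [h, h'] at hpos' <;> simp_all
  rw [hb, hfin]; push_cast; rfl

/-- The expansion of a product of factors `1 + 4 t` to second order. -/
theorem exists_prod_one_add_four_mul {ι : Type*} (s : Finset ι) (t : ι → ℂ)
    (ht : ∀ i ∈ s, IsIntegral ℤ (t i)) :
    ∃ e w : ℂ, IsIntegral ℤ e ∧ IsIntegral ℤ w ∧
      2 * e = (∑ i ∈ s, t i) ^ 2 - ∑ i ∈ s, t i ^ 2 ∧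
      ∏ i ∈ s, (1 + 4 * t i) = 1 + 4 * ∑ i ∈ s, t i + 16 * e + 64 * w := by
  classical
  induction s using Finset.induction_on with
  | empty => exact ⟨0, 0, isIntegral_zero, isIntegral_zero, by simp, by simp⟩
  | insert a s ha ih =>
    obtain ⟨e, w, he, hw, h1, h2⟩ := ih fun i hi => ht i (Finset.mem_insert_of_mem hi)
    have hta := ht a (Finset.mem_insert_self a s)
    have hts : IsIntegral ℤ (∑ i ∈ s, t i) :=
      IsIntegral.sum _ fun i hi => ht i (Finset.mem_insert_of_mem hi)
    have h4 : IsIntegral ℤ (4 : ℂ) := by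
      simpa using (isIntegral_algebraMap (R := ℤ) (A := ℂ) (x := 4))
    refine ⟨e + t a * ∑ i ∈ s, t i, w + t a * e + 4 * (t a * w), he.add (hta.mul hts),
      (hw.add (hta.mul he)).add (h4.mul (hta.mul hw)), ?_, ?_⟩
    · rw [Finset.sum_insert ha, Finset.sum_insert ha]
      linear_combination h1
    · rw [Finset.sum_insert ha, Finset.prod_insert ha, h2]
      ring

/-- The value of `gridPairProd n` modulo `64`. -/
theorem exists_int_gridPairProd (n : ℕ) : ∃ b : ℤ, gridPairProd n = b ∧
    b ≡ (-1) ^ (n ^ 2 / 4) * (1 - 4 * ((n / 2 + 1).choose 2 : ℕ) +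
      8 * (((n / 2 + 1).choose 2 : ℕ) ^ 2 - ((n + 2).choose 4 : ℕ))) [ZMOD 64] := by
  obtain ⟨b, hb⟩ := exists_int_eq_prod_twoCosRoot n 2
  have hb4 : (gridPairProd n : ℂ) = b := by
    rw [gridPairProd_cast, ← hb]
    refine Finset.prod_congr rfl fun i _ => Finset.prod_congr rfl fun j _ => ?_
    push_cast; ring
  refine ⟨b, Complex.ofReal_injective (by rw [hb4]; push_cast; rfl), ?_⟩
  set S : Finset (Σ _ : Fin n, Fin n) := Finset.univ.sigma fun i => Finset.Ioi i with hS
  set t : (Σ _ : Fin n, Fin n) → ℂ := fun p => (twoCosRoot n p.1 + twoCosRoot n p.2)⁻¹ with ht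
  have htS : ∀ p ∈ S, IsIntegral ℤ (t p) := fun p hp =>
    (isIntegral_twoCosRoot_add_inv (Finset.mem_Ioi.1 (Finset.mem_sigma.1 hp).2)).1
  obtain ⟨e, w, -, hw, h1, h2⟩ := exists_prod_one_add_four_mul S t htS
  have hs1 : ∑ p ∈ S, t p = pairSum n 1 := by
    simp only [pairSum, pow_one, hS, Finset.sum_sigma', ht]
  have hs2 : ∑ p ∈ S, t p ^ 2 = pairSum n 2 := by
    simp only [pairSum, hS, Finset.sum_sigma', ht, inv_pow]
  have hprod : (b : ℂ) = (-1) ^ (n ^ 2 / 4) * ∏ p ∈ S, (1 + 4 * t p) := by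
    rw [← prod_twoCosRoot_add, ← hb4, gridPairProd_cast, Finset.prod_sigma', Finset.prod_sigma',
      ← Finset.prod_mul_distrib]
    refine Finset.prod_congr rfl fun p hp => ?_
    have := (isIntegral_twoCosRoot_add_inv (Finset.mem_Ioi.1 (Finset.mem_sigma.1 hp).2)).2
    simp only [ht]
    field_simp
  have hchoose : (((n / 2 + 1).choose 2 : ℕ) : ℂ) = (n / 2 : ℕ) * ((n / 2 : ℕ) + 1) / 2 := by
    rw [Nat.cast_choose_two]; push_cast; ring
  set P := (n / 2 + 1).choose 2 with hP
  set Q := (n + 2).choose 4 with hQ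
  rw [hs1, hs2, pairSum_one, ← hchoose, pairSum_two] at h1
  rw [hs1, pairSum_one, ← hchoose] at h2
  set σ : ℤ := (-1) ^ (n ^ 2 / 4) with hσ
  have hσ1 : σ * σ = 1 := by rw [hσ, ← mul_pow]; simp
  have hσ2 : ((-1 : ℂ)) ^ (n ^ 2 / 4) = (σ : ℂ) := by rw [hσ]; push_cast; rfl
  rw [h2, hσ2] at hprod
  have hσ3 : (σ : ℂ) * σ = 1 := by exact_mod_cast hσ1
  set z : ℤ := 1 - 4 * (P : ℕ) + 8 * ((P : ℕ) ^ 2 - (Q : ℕ)) with hz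
  have hwz : w = (((σ * b - z : ℤ) / 64 : ℚ) : ℂ) := by
    rw [hz]
    push_cast
    linear_combination (-(σ : ℂ) / 64) * hprod +
      (-(1 / 64) * (1 - 4 * (P : ℂ) + 16 * e + 64 * w)) * hσ3 - (1 / 8) * h1
  rw [hwz] at hw
  obtain ⟨k, hk⟩ := exists_int_of_isIntegral_ratCast hw
  have hk' : σ * b - z = 64 * k := by
    have : ((σ * b - z : ℤ) : ℚ) = 64 * k := by rw [hk]; ring
    exact_mod_cast this
  refine (Int.modEq_iff_dvd.2 ⟨-(σ * k), ?_⟩)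
  linear_combination -σ * hk' + b * hσ1

theorem choose_four_modEq (k : ℕ) : ((k + 32).choose 4 : ℤ) ≡ (k.choose 4 : ℕ) [ZMOD 8] := by
  have h : (k + 32).choose 4 = k.choose 4 + 8 * (4 * k.choose 3 + 62 * k.choose 2 +
      620 * k + 4495) := by
    rw [Nat.add_choose_eq]
    simp [Finset.Nat.antidiagonal_succ]
    norm_num [Nat.choose]
    ring
  rw [h]
  push_cast
  refine (Int.modEq_iff_dvd.2 ⟨-(4 * (k.choose 3 : ℤ) + 62 * k.choose 2 + 620 * k + 4495), ?_⟩)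
  ring

theorem choose_two_add_sixteen (m : ℕ) :
    (m + 16 + 1).choose 2 = (m + 1).choose 2 + 16 * m + 136 := by
  have h1 := Nat.triangle_succ (m + 16)
  have h2 := Nat.triangle_succ m
  rw [Nat.choose_two_right, Nat.choose_two_right, Nat.add_sub_cancel, Nat.add_sub_cancel]
  have : (m + 16 + 1) * (m + 16) = (m + 1) * m + 2 * (16 * m + 136) := by ring
  omega

theorem neg_one_pow_sq_div_four (n : ℕ) :
    (-1 : ℤ) ^ ((n + 32) ^ 2 / 4) = (-1) ^ (n ^ 2 / 4) := by
  have h : (n + 32) ^ 2 / 4 = n ^ 2 / 4 + 2 * (8 * n + 128) := by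
    rw [show (n + 32) ^ 2 = n ^ 2 + 4 * (2 * (8 * n + 128)) by ring]; omega
  rw [h, pow_add, pow_mul]; simp

theorem corollary1 :
    ∃ B : ℕ → ℤ,
      (∀ n : ℕ, 0 < B n ∧ (dimerCount n : ℤ) = 2 ^ n * B n ^ 2) ∧
      ∀ n : ℕ, B (n + 32) ≡ B n + 32 [ZMOD 64] := by
  choose B hB hmod using exists_int_gridPairProd
  refine ⟨B, fun n => ⟨?_, ?_⟩, fun n => ?_⟩
  · have := gridPairProd_pos n
    rw [hB] at this
    exact_mod_cast this
  · have := dimerCount_eq n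
    rw [hB] at this
    exact_mod_cast this
  · refine (hmod (n + 32)).trans (Int.ModEq.trans ?_ ((hmod n).symm.add_right 32))
    rw [neg_one_pow_sq_div_four, show (n + 32) / 2 + 1 = n / 2 + 16 + 1 by omega,
      choose_two_add_sixteen, show n + 32 + 2 = n + 2 + 32 by ring]
    obtain ⟨c, hc⟩ := Int.modEq_iff_dvd.1 (choose_four_modEq (n + 2))
    rw [Int.modEq_iff_dvd]
    generalize hP : (n / 2 + 1).choose 2 = P
    generalize n / 2 = m
    generalize hx : (((n + 2 + 32).choose 4 : ℕ) : ℤ) = x at hc ⊢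
    generalize hy : (((n + 2).choose 4 : ℕ) : ℤ) = y at hc ⊢
    rcases neg_one_pow_eq_or ℤ (n ^ 2 / 4) with h | h <;> rw [h] <;> push_cast
    · refine ⟨m - (4 * m * P + 34 * P + 32 * m ^ 2 + 544 * m + 2312) + 9 - c, ?_⟩
      linear_combination -8 * hc
    · refine ⟨-m + (4 * m * P + 34 * P + 32 * m ^ 2 + 544 * m + 2312) - 8 + c, ?_⟩
      linear_combination 8 * hc
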